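/- Let $d\ge 1$, let $\nu$ be the Wiener measure on $\Omega=C_0([0,1];\mathbb R^d)=\{\gamma\in C([0,1];\mathbb R^d):\gamma(0)=0\}$, and let $\mathbb H$ be the Cameron–Martin space with $\langle h,k\rangle_{\mathbb H}=\int_0^1\langle h'(x),k'(x)\rangle_{\mathbb R^d}\,dx$. Let $Z$ be the set of all functions $F(\gamma)=f(\gamma(s_1),\dots,\gamma(s_k))$ with $k\in\mathbb N$, $0<s_1<\dots<s_k=1$ and $f\in C_p^\infty((\mathbb R^d)^k)$ (smooth, with $f$ and all its derivatives of at most polynomial growth), and for such $F$ put $D_sF(\gamma)=\sum_{i=1}^k (s_i\wedge s)\,(\nabla_{s_i}f)(\gamma(s_1),\dots,\gamma(s_k))$, $s\in[0,1]$, where $\nabla_{s_i}f$ is the gradient of $f$ in its $i$th variable. Let $H_1=1$ and, for $m\ge 0$ and $1\le k\le 2^m$, let $H_{2^m+k}$ be equal to $2^{m/2}$ on $[\frac{k-1}{2^m},\frac{2k-1}{2^{m+1}})$, to $-2^{m/2}$ on $[\frac{2k-1}{2^{m+1}},\frac{k}{2^m})$ and to $0$ elsewhere; with the standard basis $(e_j)$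 of $\mathbb R^d$ put $g_{d(r-1)+j}=H_r e_j$ ($r\ge1$, $1\le j\le d$) and $S_n(s)=\int_0^s g_n(u)\,du$. Let $0<\lambda_1\le\lambda_2\le\dots$ be a non-decreasing sequence of positive numbers. Let $\varphi$ be a measurable function on $\Omega$ with $0<\varphi\le c$ ($\nu$-a.e.) for some constant $c$, and suppose that $$\frac{F}{\varphi}\in L^1(\nu)\qquad\text{for all }F\in Z .$$ Consider $$\mathcal E(F,G)=\sum_{i=1}^\infty\lambda_i\int\langle S_i,DF\rangle_{\mathbb H}\,\langle S_i,DG\rangle_{\mathbb H}\;\varphi\,d\nu$$ on $Z_{\mathcal E}=\{F\in Z:\mathcal E(F,F)<\infty\}$. Then: 1. $Z_{\mathcal E}=Z$ as soon as $\sum_{p\ge1}2^{-p}\lambda_{i_{p,j}}<\infty$ for all $j\in\{1,\dots,d\}$, where $i_{p,j}=2^{p-1}(d+j-1)+1+\sum_{q=1}^{p-1}c_q2^{p-q-1}$ for some sequence of binary digits $c_1,c_2,\dots\in\{0,1\}$. 2. $(\mathcal E,Z_{\mathcal E})$ is closable on $L^2(\varphi\nu)$. 3. Its closure $(\mathcal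 E,D_Z(\mathcal E))$ is a (symmetric) Dirichlet form on $L^2(\varphi\nu)$: it is a densely defined, nonnegative, symmetric, closed bilinear form such that for every $u\in D_Z(\mathcal E)$ one has $u^+\wedge1\in D_Z(\mathcal E)$ and $\mathcal E(u^+\wedge 1,u^+\wedge1)\le\mathcal E(u,u)$. -/

import Mathlib

open MeasureTheory ProbabilityTheory Filter Set
open scoped ENNReal Topology unitInterval

noncomputable section

/-! ### Bilinear forms on `L²`, closability, closures, Dirichlet forms -/

section Forms

/-- A bilinear form `(𝓔, D(𝓔))` on `L²(m)`, defined on a linear subspace `D(𝓔)` of `L²(m)`. -/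
structure L2Form {X : Type*} [MeasurableSpace X] (m : Measure X) where
  domain : Submodule ℝ (Lp ℝ 2 m)
  form : domain →ₗ[ℝ] domain →ₗ[ℝ] ℝ

/-- A (symmetric) Dirichlet form on `L²(m)`: a densely defined, symmetric, nonnegative, closed
bilinear form on which the unit contraction operates. -/
structure L2Form.IsDirichletForm {X : Type*} [MeasurableSpace X] {m : Measure X}
    (Q : L2Form m) : Prop where
  dense : Dense (Q.domain : Set (Lp ℝ 2 m))
  symm : ∀ u v, Q.form u v = Q.form v u
  nonneg : ∀ u, 0 ≤ Q.form u u
  /-- the domain is complete for the norm `(𝓔(u,u) + ‖u‖²)^(1/2)` -/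
  closed : ∀ u : ℕ → Q.domain,
    CauchySeq (fun n => (u n : Lp ℝ 2 m)) →
    Tendsto (fun p : ℕ × ℕ => Q.form (u p.1 - u p.2) (u p.1 - u p.2)) atTop (𝓝 0) →
    ∃ v : Q.domain, Tendsto (fun n => (u n : Lp ℝ 2 m)) atTop (𝓝 (v : Lp ℝ 2 m)) ∧
      Tendsto (fun n => Q.form (u n - v) (u n - v)) atTop (𝓝 0)
  /-- if `u ∈ D(𝓔)` then `u⁺ ∧ 1 ∈ D(𝓔)` and `𝓔(u⁺ ∧ 1, u⁺ ∧ 1) ≤ 𝓔(u, u)` -/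
  unit_contraction : ∀ u : Q.domain, ∃ v : Q.domain,
    ((v : Lp ℝ 2 m) : X → ℝ) =ᵐ[m] (fun x => min (max ((u : Lp ℝ 2 m) x) 0) 1) ∧
      Q.form v v ≤ Q.form u u

/-- `(E, D)` (a form on a set `D` of square integrable functions) is closable on `L²(m)`. -/
def IsClosableForm {X : Type*} [MeasurableSpace X] (m : Measure X)
    (D : Set (X → ℝ)) (E : (X → ℝ) → (X → ℝ) → ℝ) : Prop :=
  ∀ F : ℕ → X → ℝ, (∀ n, F n ∈ D) →
    Tendsto (fun n => eLpNorm (F n) 2 m) atTop (𝓝 0) →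
    Tendsto (fun p : ℕ × ℕ => E (F p.1 - F p.2) (F p.1 - F p.2)) atTop (𝓝 0) →
    Tendsto (fun n => E (F n) (F n)) atTop (𝓝 0)

/-- The sequence `F` in `D` is `E`-Cauchy and converges to `u` in `L²(m)`. -/
structure Approximates {X : Type*} [MeasurableSpace X] (m : Measure X)
    (D : Set (X → ℝ)) (E : (X → ℝ) → (X → ℝ) → ℝ) (F : ℕ → X → ℝ) (u : Lp ℝ 2 m) : Prop where
  mem : ∀ n, F n ∈ D
  tendsto : Tendsto (fun n => eLpNorm (F n - (u : X → ℝ)) 2 m) atTop (𝓝 0)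
  cauchy : Tendsto (fun p : ℕ × ℕ => E (F p.1 - F p.2) (F p.1 - F p.2)) atTop (𝓝 0)

/-- `Q` is the closure of `(E, D)` on `L²(m)`: its domain consists of the `L²`-limits of
`E`-Cauchy sequences in `D`, and its values are the limits of the values of `E` along *all*
such sequences. This determines `Q` uniquely. -/
structure L2Form.IsClosureOf {X : Type*} [MeasurableSpace X] {m : Measure X} (Q : L2Form m)
    (D : Set (X → ℝ)) (E : (X → ℝ) → (X → ℝ) → ℝ) : Prop where
  mem_domain_iff : ∀ u : Lp ℝ 2 m, u ∈ Q.domain ↔ ∃ F, Approximates m D E F u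
  tendsto_form : ∀ (u v : Q.domain) (F G : ℕ → X → ℝ),
    Approximates m D E F u → Approximates m D E G v →
      Tendsto (fun n => E (F n) (G n)) atTop (𝓝 (Q.form u v))

end Forms

/-! ### Path space and Wiener measure -/

section PathSpace

/-- `Ω = C₀([0,1]; ℝᵈ)`. -/
def PathSpace (d : ℕ) : Type :=
  {γ : C(I, EuclideanSpace ℝ (Fin d)) // γ 0 = 0}

instance (d : ℕ) : CoeFun (PathSpace d) (fun _ => I → EuclideanSpace ℝ (Fin d)) :=
  ⟨fun γ => γ.1⟩

/-- The σ-algebra generated by the evaluations (equivalently, the Borel σ-algebra of the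
supremum norm). -/
instance (d : ℕ) : MeasurableSpace (PathSpace d) :=
  MeasurableSpace.comap (fun (γ : PathSpace d) (s : I) => γ s) MeasurableSpace.pi

/-- `ν` is the Wiener measure on `C₀([0,1]; ℝᵈ)`: the coordinate process has independent
increments, and `γ(t) - γ(s)` has law `N(0, (t - s) Id)` for `s ≤ t`. -/
structure IsWienerMeasure {d : ℕ} (ν : Measure (PathSpace d)) : Prop where
  isProbabilityMeasure : IsProbabilityMeasure ν
  hasIndepIncrements : HasIndepIncrements (fun (s : I) (γ : PathSpace d) => γ s) ν
  map_increment : ∀ s t : I, s ≤ t →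
    ν.map (fun γ => γ t - γ s) =
      multivariateGaussian 0 (((t : ℝ) - (s : ℝ)) • (1 : Matrix (Fin d) (Fin d) ℝ))

/-- The measure `φν`. -/
def weightedMeasure {d : ℕ} (ν : Measure (PathSpace d)) (φ : PathSpace d → ℝ) :
    Measure (PathSpace d) :=
  ν.withDensity (fun γ => ENNReal.ofReal (φ γ))

end PathSpace

/-! ### Cylindrical functions and their gradient -/

section Cylinder

/-- Data of a smooth cylindrical function `F(γ) = f(γ(s₁), …, γ(sₖ))`: times
`0 < s₁ < … < sₖ = 1` (here there are `k + 1` of them) and a smooth function `f` which has,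
together with all its derivatives, at most polynomial growth. -/
structure CylinderData (d : ℕ) where
  k : ℕ
  s : Fin (k + 1) → I
  strictMono : StrictMono s
  pos : 0 < s 0
  last : s (Fin.last k) = 1
  f : (Fin (k + 1) → EuclideanSpace ℝ (Fin d)) → ℝ
  growth : Function.HasTemperateGrowth f

/-- `F(γ) = f(γ(s₁), …, γ(sₖ))`. -/
def CylinderData.toFun {d : ℕ} (Φ : CylinderData d) (γ : PathSpace d) : ℝ :=
  Φ.f (fun i => γ (Φ.s i))

/-- `(∇_{sᵢ} f)(γ)`: the gradient of `f` in its `i`th variable, the others being fixed. -/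
def CylinderData.partialGradient {d : ℕ} (Φ : CylinderData d) (i : Fin (Φ.k + 1))
    (γ : PathSpace d) : EuclideanSpace ℝ (Fin d) :=
  gradient (fun y => Φ.f (Function.update (fun l => γ (Φ.s l)) i y)) (γ (Φ.s i))

/-- `D_s F(γ) = ∑ᵢ (sᵢ ∧ s) (∇_{sᵢ} f)(γ)`. -/
def CylinderData.grad {d : ℕ} (Φ : CylinderData d) (γ : PathSpace d) (s : ℝ) :
    EuclideanSpace ℝ (Fin d) :=
  ∑ i, min (Φ.s i : ℝ) s • Φ.partialGradient i γ

/-- The set `Z` of smooth cylindrical functions on `Ω`. -/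
def cylinderFunctions (d : ℕ) : Set (PathSpace d → ℝ) :=
  Set.range CylinderData.toFun

open Classical in
/-- The gradient `D F` of `F ∈ Z`; it does not depend on the representation of `F`, see
`cylinderGradient_eq`. -/
def cylinderGradient {d : ℕ} (F : PathSpace d → ℝ) (γ : PathSpace d) :
    ℝ → EuclideanSpace ℝ (Fin d) :=
  if h : F ∈ cylinderFunctions d then h.choose.grad γ else 0

/-- The path `γ + t h` for `h(r) = (r ∧ s) e`. -/
def shiftPath {d : ℕ} (γ : PathSpace d) (e : EuclideanSpace ℝ (Fin d)) (s : ℝ)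
    (hs : 0 ≤ s) (t : ℝ) : PathSpace d :=
  ⟨⟨fun r => γ r + t • (min (r : ℝ) s • e), by
    have := γ.1.continuous
    fun_prop⟩, by
    have := γ.2
    simp [this, hs]⟩

/-- `⟨D_s F(γ), e⟩` is the derivative of `F` at `γ` in the direction `r ↦ (r ∧ s) e`. -/
theorem CylinderData.hasDerivAt_shift {d : ℕ} (Φ : CylinderData d) (γ : PathSpace d)
    (e : EuclideanSpace ℝ (Fin d)) (s : ℝ) (hs : 0 ≤ s) :
    HasDerivAt (fun t => Φ.toFun (shiftPath γ e s hs t)) (inner ℝ (Φ.grad γ s) e) 0 := by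
  have hf : Differentiable ℝ Φ.f := Φ.growth.1.differentiable (by simp)
  set x : Fin (Φ.k + 1) → EuclideanSpace ℝ (Fin d) := fun l => γ (Φ.s l) with hx
  have hpart : ∀ (i : Fin (Φ.k + 1)) (v : EuclideanSpace ℝ (Fin d)),
      inner ℝ (Φ.partialGradient i γ) v = fderiv ℝ Φ.f x (Pi.single i v) := by
    intro i v
    have hu : Function.update x i (x i) = x := Function.update_eq_self i x
    have h1 := hasFDerivAt_update (𝕜 := ℝ) x (i := i) (x i)
    have h2 : HasFDerivAt Φ.f (fderiv ℝ Φ.f x) (Function.update x i (x i)) := by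
      rw [hu]; exact (hf x).hasFDerivAt
    have h3 := h2.comp (x i) h1
    have h4 := h3.differentiableAt.hasGradientAt.hasFDerivAt
    have h5 := congrArg (fun L => L v) (h4.unique h3)
    simp only [InnerProductSpace.toDual_apply_apply] at h5
    rw [CylinderData.partialGradient]
    refine h5.trans ?_
    simp only [ContinuousLinearMap.comp_apply]
    congr 1
    ext l
    by_cases hl : l = i
    · subst hl; simp
    · simp [hl]
  have hline : HasDerivAt (fun t : ℝ => x + t • (fun l => min (Φ.s l : ℝ) s • e))
      (fun l => min (Φ.s l : ℝ) s • e) 0 := by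
    simpa using ((hasDerivAt_id (0 : ℝ)).smul_const
      (fun l : Fin (Φ.k + 1) => min (Φ.s l : ℝ) s • e)).const_add x
  have h0 : HasFDerivAt Φ.f (fderiv ℝ Φ.f x)
      (x + (0 : ℝ) • (fun l => min (Φ.s l : ℝ) s • e)) := by
    simpa using (hf x).hasFDerivAt
  have h := h0.comp_hasDerivAt (0 : ℝ) hline
  have hval : inner ℝ (Φ.grad γ s) e =
      fderiv ℝ Φ.f x (fun l => min (Φ.s l : ℝ) s • e) := by
    have hsum : (fun l => min (Φ.s l : ℝ) s • e) =
        ∑ i, Pi.single (M := fun _ => EuclideanSpace ℝ (Fin d)) i (min (Φ.s i : ℝ) s • e) :=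
      (Finset.univ_sum_single _).symm
    rw [hsum, map_sum, CylinderData.grad, sum_inner]
    refine Finset.sum_congr rfl fun i _ => ?_
    rw [← hpart, inner_smul_left, inner_smul_right]
    simp
  rw [hval]
  exact h

/-- `D F` does not depend on the representation of `F` as a cylindrical function. -/
theorem cylinderGradient_eq {d : ℕ} (Φ : CylinderData d) (γ : PathSpace d) (s : ℝ)
    (hs : 0 ≤ s) : cylinderGradient Φ.toFun γ s = Φ.grad γ s := by
  have hmem : Φ.toFun ∈ cylinderFunctions d := ⟨Φ, rfl⟩
  rw [cylinderGradient, dif_pos hmem]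
  refine ext_inner_right ℝ fun e => ?_
  have h1 := hmem.choose.hasDerivAt_shift γ e s hs
  rw [hmem.choose_spec] at h1
  exact h1.unique (Φ.hasDerivAt_shift γ e s hs)

end Cylinder

/-! ### Cameron–Martin product, Haar and Schauder functions, the form -/

section Form

/-- The inner product `⟨h, k⟩ = ∫₀¹ ⟨h'(x), k'(x)⟩ dx` of the Cameron–Martin space. -/
def cmInner {d : ℕ} (h k : ℝ → EuclideanSpace ℝ (Fin d)) : ℝ :=
  ∫ x in (0 : ℝ)..1, inner ℝ (deriv h x) (deriv k x)

/-- The Haar functions, indexed from `0`: `haar n` is `H_{n+1}`, where `H_1 = 1` and, for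
`n + 1 = 2 ^ m + k` with `1 ≤ k ≤ 2 ^ m`, `H_{n+1}` is `2 ^ (m/2)` on
`[(k-1)/2^m, (2k-1)/2^(m+1))`, `-2 ^ (m/2)` on `[(2k-1)/2^(m+1), k/2^m)` and `0` elsewhere. -/
def haar (n : ℕ) (t : ℝ) : ℝ :=
  if n = 0 then 1 else
    let m : ℕ := Nat.log 2 n
    let k : ℝ := (n : ℝ) + 1 - 2 ^ m
    if (k - 1) / 2 ^ m ≤ t ∧ t < (2 * k - 1) / 2 ^ (m + 1) then √(2 ^ m)
    else if (2 * k - 1) / 2 ^ (m + 1) ≤ t ∧ t < k / 2 ^ m then -√(2 ^ m)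
    else 0

/-- `haarVec d n` is `g_{n+1}`, where `g_{d(r-1)+j} = H_r e_j` for `r ≥ 1` and `1 ≤ j ≤ d`. -/
def haarVec (d n : ℕ) (t : ℝ) : EuclideanSpace ℝ (Fin d) :=
  WithLp.toLp 2 (fun j => if (j : ℕ) = n % d then haar (n / d) t else 0)

/-- The Schauder functions: `schauder d n` is `S_{n+1}(s) = ∫₀ˢ g_{n+1}(u) du`. -/
def schauder (d n : ℕ) (s : ℝ) : EuclideanSpace ℝ (Fin d) :=
  ∫ u in (0 : ℝ)..s, haarVec d n u

/-- The diffusion form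
`𝓔(F, G) = ∑ᵢ λᵢ ∫ ⟨Sᵢ, DF⟩ ⟨Sᵢ, DG⟩ dm`, with `lam n` standing for `λ_{n+1}`. -/
def diffusionForm {d : ℕ} (lam : ℕ → ℝ) (m : Measure (PathSpace d))
    (F G : PathSpace d → ℝ) : ℝ :=
  ∑' n, lam n * ∫ γ, cmInner (schauder d n) (cylinderGradient F γ) *
    cmInner (schauder d n) (cylinderGradient G γ) ∂m

/-- `𝓔(F, F) = ∑ᵢ λᵢ ∫ ⟨Sᵢ, DF⟩² dm` as an element of `[0, ∞]`. -/
def diffusionEnergy {d : ℕ} (lam : ℕ → ℝ) (m : Measure (PathSpace d))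
    (F : PathSpace d → ℝ) : ℝ≥0∞ :=
  ∑' n, ENNReal.ofReal (lam n) *
    ∫⁻ γ, ENNReal.ofReal (cmInner (schauder d n) (cylinderGradient F γ) ^ 2) ∂m

/-- The functions `F ∈ Z` for which the series defining `𝓔(F, F)` converges. -/
def initialDomain {d : ℕ} (lam : ℕ → ℝ) (m : Measure (PathSpace d)) :
    Set (PathSpace d → ℝ) :=
  {F | F ∈ cylinderFunctions d ∧ diffusionEnergy lam m F < ∞}

/-- The index `i_{p,j} = 2^(p-1) (d + j - 1) + 1 + ∑_{q=1}^{p-1} c_q 2^(p-q-1)`, for `p ≥ 1`,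
`1 ≤ j ≤ d` and binary digits `c_q`, shifted to a numbering of `j` and of the `λ`'s from `0`. -/
def haarIndex (d : ℕ) (c : ℕ → Fin 2) (p : ℕ) (j : Fin d) : ℕ :=
  2 ^ (p - 1) * (d + j) + ∑ q ∈ Finset.Ico 1 p, (c q : ℕ) * 2 ^ (p - q - 1)

end Form

end

noncomputable section

/-! ### Functions of temperate growth -/

section TemperateGrowth

open scoped ContDiff

variable {E F : Type*} [NormedAddCommGroup E] [NormedSpace ℝ E]
  [NormedAddCommGroup F] [NormedSpace ℝ F]

/-! The form is the squared norm of a gradient, `F ↦ (√λ_n ⟨S_n, DF⟩)_n`, with values in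
`ℓ²(L²(φν))`, so closability of the form is closability of this operator, and it may be checked one
component at a time (`diffusionGrad_closable`). No regularity of `φ` is available, so the
integration by parts is done under `ν` and not under `φν`. For cylindrical `G` the functional `u ↦ ∫
G u dν` is continuous on `L²(φν)`: it is the inner product with `G/φ`, whose squared norm is `∫ G²/φ
dν`, finite because `G²` is again cylindrical (`exists_inner_eq_integral`).

Since Haar functions are step functions, `S_n` is on `[0,1]` a finite combination of `r ↦ (r ∧ t)
e`. The adjoint of `⟨S_n, D·⟩` under `ν` is therefore `G ↦ G W_n - ⟨S_n, DG⟩` with `W_n` a finite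
combination of `⟨γ(t), e⟩`, and it preserves cylindrical functions. If `F_k → 0` in `L²(φν)` and the
`n`th components converge to `y_n`, moving the derivative to `G` gives `∫ G y_n dν = 0` for every
cylindrical `G`, hence `y_n = 0` by uniqueness of characteristic functions
(`ae_eq_zero_of_integral_cylinder_eq_zero`). Integration by parts itself
(`IsWienerMeasure.integral_fderiv_min`) is Stein's identity in the one Gaussian variable `⟨e,
γ(t)⟩`, after subtracting from each `γ(s_i)` its projection on that variable.

For the Markov property, smooth approximations of the unit contraction with derivative bounded by
`1` decrease the energy by the chain rule. Along an approximating sequence the gradients of the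
contracted functions stay bounded, and a convexity substitute for weak compactness
(`exists_mem_of_tendsto_of_norm_le`) puts the limit in the closed graph without increasing the norm.
The domain is dense because at a dyadic time all but finitely many Schauder functions vanish, so
cylindrical functions with dyadic times have finite energy for any `λ`.

For the first claim, at a given time at most one scalar Schauder function of each level `m` is
nonzero, and its square is at most `2^(-m)`. Monotonicity of `λ` bounds the coefficients of level
`m` by `λ` at the index `i_{m+2,1}`, and the assumed series dominates the energy
(`tsum_mul_sq_integral_haar_lt_top`). -/

theorem Function.HasTemperateGrowth.fderiv {f : E → F} (hf : f.HasTemperateGrowth) :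
    (_root_.fderiv ℝ f).HasTemperateGrowth := by
  refine ⟨hf.1.fderiv_right (by simp), fun n => ?_⟩
  obtain ⟨k, C, h⟩ := hf.2 (n + 1)
  refine ⟨k, C, fun x => ?_⟩
  have := h x
  rwa [iteratedFDeriv_succ_eq_comp_right, Function.comp_apply, LinearIsometryEquiv.norm_map] at this

theorem Function.HasTemperateGrowth.fderiv_apply {f : E → F} (hf : f.HasTemperateGrowth) (v : E) :
    (fun x => _root_.fderiv ℝ f x v).HasTemperateGrowth :=
  (ContinuousLinearMap.apply ℝ F v).hasTemperateGrowth.comp hf.fderiv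

theorem Function.HasTemperateGrowth.differentiable {f : E → F} (hf : f.HasTemperateGrowth) :
    Differentiable ℝ f :=
  hf.1.differentiable (by simp)

theorem Real.hasTemperateGrowth_cos : Real.cos.HasTemperateGrowth :=
  ⟨Real.contDiff_cos, fun n => ⟨0, 1, fun x => by
    simpa [norm_iteratedFDeriv_eq_norm_iteratedDeriv] using Real.abs_iteratedDeriv_cos_le_one n x⟩⟩

theorem Real.hasTemperateGrowth_sin : Real.sin.HasTemperateGrowth :=
  ⟨Real.contDiff_sin, fun n => ⟨0, 1, fun x => by
    simpa [norm_iteratedFDeriv_eq_norm_iteratedDeriv] using Real.abs_iteratedDeriv_sin_le_one n x⟩⟩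

/-- A smooth approximation of `t ↦ max t 0`. -/
def softPos (ε t : ℝ) : ℝ := (t + √(t ^ 2 + ε ^ 2)) / 2

theorem hasTemperateGrowth_softPos {ε : ℝ} (hε : 0 < ε) : (softPos ε).HasTemperateGrowth := by
  have h := (Function.hasTemperateGrowth_one_add_norm_sq_rpow ℝ (1 / 2)).comp
    (ε⁻¹ • ContinuousLinearMap.id ℝ ℝ).hasTemperateGrowth
  have h2 : softPos ε = fun t => (1 / 2) * (t + ε * ((fun x : ℝ => (1 + ‖x‖ ^ 2) ^ (1 / 2 : ℝ)) ∘
      (ε⁻¹ • ContinuousLinearMap.id ℝ ℝ)) t) := by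
    ext t
    have : √(t ^ 2 + ε ^ 2) = ε * √(1 + (ε⁻¹ * t) ^ 2) := by
      rw [← Real.sqrt_sq hε.le, ← Real.sqrt_mul (by positivity), Real.sqrt_sq hε.le]
      congr 1
      field_simp
      ring
    simp only [softPos, this, Function.comp_apply, ← Real.sqrt_eq_rpow]
    simp [mul_pow, abs_of_pos hε]
    ring
  rw [h2]
  fun_prop

theorem abs_softPos_sub_le {ε : ℝ} (hε : 0 < ε) (t : ℝ) : |softPos ε t - max t 0| ≤ ε / 2 := by
  have h1 : |t| ≤ √(t ^ 2 + ε ^ 2) := Real.abs_le_sqrt (by nlinarith)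
  have h2 : √(t ^ 2 + ε ^ 2) ≤ |t| + ε := by
    rw [Real.sqrt_le_left (by positivity)]
    nlinarith [sq_abs t, abs_nonneg t]
  have h3 : max t 0 = (t + |t|) / 2 := by
    rcases le_total t 0 with h | h
    · rw [max_eq_right h, abs_of_nonpos h]; ring
    · rw [max_eq_left h, abs_of_nonneg h]; ring
  rw [h3, softPos, abs_le]
  constructor <;> linarith

theorem hasDerivAt_softPos {ε : ℝ} (hε : 0 < ε) (t : ℝ) :
    HasDerivAt (softPos ε) ((1 + t / √(t ^ 2 + ε ^ 2)) / 2) t := by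
  have h1 : HasDerivAt (fun t : ℝ => t ^ 2 + ε ^ 2) (2 * t) t := by
    simpa using (hasDerivAt_pow 2 t).add_const (ε ^ 2)
  have h2 := ((hasDerivAt_id t).add (h1.sqrt (by positivity))).div_const 2
  refine h2.congr_deriv ?_
  field_simp

/-- A smooth approximation of the unit contraction `t ↦ t⁺ ∧ 1`. -/
def softClamp (ε t : ℝ) : ℝ := softPos ε t - softPos ε (t - 1)

theorem hasTemperateGrowth_softClamp {ε : ℝ} (hε : 0 < ε) : (softClamp ε).HasTemperateGrowth :=
  (hasTemperateGrowth_softPos hε).sub ((hasTemperateGrowth_softPos hε).comp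
    (Function.HasTemperateGrowth.id'.sub (.const 1)))

theorem abs_softClamp_sub_le {ε : ℝ} (hε : 0 < ε) (t : ℝ) :
    |softClamp ε t - min (max t 0) 1| ≤ ε := by
  have h1 := abs_softPos_sub_le hε t
  have h2 := abs_softPos_sub_le hε (t - 1)
  have h3 : min (max t 0) 1 = max t 0 - max (t - 1) 0 := by
    rcases le_total t 0 with h | h
    · rw [max_eq_right h, max_eq_right (by linarith)]; simp
    · rw [max_eq_left h]
      rcases le_total t 1 with h' | h'
      · rw [min_eq_left h', max_eq_right (by linarith)]; simp
      · rw [min_eq_right h', max_eq_left (by linarith)]; simp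
  rw [h3, softClamp]
  rw [abs_le] at *
  constructor <;> linarith [h1.1, h1.2, h2.1, h2.2]

theorem monotone_div_sqrt {ε : ℝ} (hε : 0 < ε) : Monotone (fun t : ℝ => t / √(t ^ 2 + ε ^ 2)) := by
  have hd : ∀ t, HasDerivAt (fun t : ℝ => t / √(t ^ 2 + ε ^ 2))
      (ε ^ 2 / (√(t ^ 2 + ε ^ 2) * (t ^ 2 + ε ^ 2))) t := by
    intro t
    have h1 : HasDerivAt (fun t : ℝ => t ^ 2 + ε ^ 2) (2 * t) t := by
      simpa using (hasDerivAt_pow 2 t).add_const (ε ^ 2)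
    have hpos : 0 < t ^ 2 + ε ^ 2 := by positivity
    have hs : √(t ^ 2 + ε ^ 2) ^ 2 = t ^ 2 + ε ^ 2 := Real.sq_sqrt hpos.le
    have hs0 : 0 < √(t ^ 2 + ε ^ 2) := Real.sqrt_pos.2 hpos
    refine ((hasDerivAt_id t).div (h1.sqrt hpos.ne') hs0.ne').congr_deriv ?_
    simp only [id]
    field_simp
    rw [hs]
    ring
  refine monotone_of_deriv_nonneg (fun t => (hd t).differentiableAt) fun t => ?_
  rw [(hd t).deriv]
  positivity

/-- The derivative is half the difference of two values of `t / √(t ^ 2 + ε ^ 2)`, both in `[-1,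
1]`. The bound is what keeps the energy from growing under composition. -/
theorem exists_hasDerivAt_softClamp {ε : ℝ} (hε : 0 < ε) (t : ℝ) :
    ∃ c : ℝ, |c| ≤ 1 ∧ HasDerivAt (softClamp ε) c t := by
  have h2 : HasDerivAt (fun t => softPos ε (t - 1)) _ t :=
    (hasDerivAt_softPos hε (t - 1)).comp_sub_const t 1
  have hb : ∀ t : ℝ, |t / √(t ^ 2 + ε ^ 2)| ≤ 1 := by
    intro t
    rw [abs_div, abs_of_nonneg (Real.sqrt_nonneg _)]
    exact div_le_one_of_le₀ (Real.abs_le_sqrt (by nlinarith)) (Real.sqrt_nonneg _)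
  refine ⟨_, ?_, (hasDerivAt_softPos hε t).sub h2⟩
  have h3 := monotone_div_sqrt hε (show t - 1 ≤ t by linarith)
  have h4 := abs_le.1 (hb t)
  have h5 := abs_le.1 (hb (t - 1))
  simp only at h3
  rw [abs_le]
  constructor <;> linarith [h4.1, h4.2, h5.1, h5.2]

end TemperateGrowth

/-! ### The algebra of cylindrical functions -/

section CylinderAlgebra

variable {d : ℕ}

/-- The times may be unordered, repeated, equal to `0`, or omit `1`. Adding `1`, deleting `0` (where
every path vanishes) and sorting gives admissible times. All algebraic properties of cylindrical
functions can then be proved with arbitrary finite index types. -/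
theorem comp_eval_mem_cylinderFunctions {ι : Type*} [Fintype ι] (s : ι → I)
    {f : (ι → EuclideanSpace ℝ (Fin d)) → ℝ} (hf : f.HasTemperateGrowth) :
    (fun γ : PathSpace d => f (fun i => γ (s i))) ∈ cylinderFunctions d := by
  classical
  set T : Finset I := insert 1 ((Finset.univ.image s).erase 0) with hT
  have h1T : (1 : I) ∈ T := Finset.mem_insert_self _ _
  have h0T : ∀ t ∈ T, 0 < t := by
    intro t ht
    rcases Finset.mem_insert.1 ht with rfl | h
    · exact zero_lt_one
    · exact unitInterval.pos_iff_ne_zero.2 (Finset.mem_erase.1 h).1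
  have hsT : ∀ i, s i ∉ T → s i = 0 := by
    intro i hi
    by_contra h0
    exact hi (Finset.mem_insert_of_mem (Finset.mem_erase.2 ⟨h0, by simp⟩))
  obtain ⟨k, hk⟩ : ∃ k, T.card = k + 1 :=
    Nat.exists_eq_succ_of_ne_zero (Finset.card_pos.2 ⟨1, h1T⟩).ne'
  -- `L` recovers the original variables from the sorted ones: equal times read the same coordinate,
  -- and the time `0` reads the constant `0`.
  let L : (Fin (k + 1) → EuclideanSpace ℝ (Fin d)) →L[ℝ] (ι → EuclideanSpace ℝ (Fin d)) :=
    ContinuousLinearMap.pi fun i => if h : s i ∈ T then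
      ContinuousLinearMap.proj ((T.orderIsoOfFin hk).symm ⟨s i, h⟩) else 0
  refine ⟨⟨k, T.orderEmbOfFin hk, (T.orderEmbOfFin hk).strictMono,
    h0T _ (Finset.orderEmbOfFin_mem _ _ _), ?_, f ∘ L, hf.comp L.hasTemperateGrowth⟩, ?_⟩
  · have h := Finset.orderEmbOfFin_last hk (Nat.succ_pos k)
    have h2 : (⟨k + 1 - 1, Nat.sub_lt (Nat.succ_pos k) (Nat.succ_pos 0)⟩ : Fin (k + 1)) = Fin.last k :=
      Fin.ext (by simp)
    rw [h2] at h
    rw [h]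
    exact le_antisymm unitInterval.le_one' (Finset.le_max' _ _ h1T)
  · ext γ
    simp only [CylinderData.toFun, Function.comp_apply]
    congr 1
    ext1 i
    simp only [L, ContinuousLinearMap.coe_pi']
    split_ifs with h
    · simp only [ContinuousLinearMap.proj_apply]
      congr 1
      have := (T.orderIsoOfFin hk).apply_symm_apply ⟨s i, h⟩
      exact congrArg Subtype.val this
    · simp [hsT i h, γ.2]

theorem exists_comp_eval {F : PathSpace d → ℝ} (hF : F ∈ cylinderFunctions d) :
    ∃ (k : ℕ) (s : Fin k → I) (f : (Fin k → EuclideanSpace ℝ (Fin d)) → ℝ),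
      f.HasTemperateGrowth ∧ F = fun γ => f (fun i => γ (s i)) := by
  obtain ⟨Φ, rfl⟩ := hF
  exact ⟨_, Φ.s, Φ.f, Φ.growth, rfl⟩

/-- Two cylindrical functions can be represented with the same times. -/
theorem exists_comp_eval₂ {F G : PathSpace d → ℝ} (hF : F ∈ cylinderFunctions d)
    (hG : G ∈ cylinderFunctions d) :
    ∃ (ι : Type) (_ : Fintype ι) (s : ι → I) (f g : (ι → EuclideanSpace ℝ (Fin d)) → ℝ),
      f.HasTemperateGrowth ∧ g.HasTemperateGrowth ∧
      F = (fun γ => f (fun i => γ (s i))) ∧ G = (fun γ => g (fun i => γ (s i))) := by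
  obtain ⟨k, s, f, hf, rfl⟩ := exists_comp_eval hF
  obtain ⟨l, t, g, hg, rfl⟩ := exists_comp_eval hG
  let L₁ : (Fin k ⊕ Fin l → EuclideanSpace ℝ (Fin d)) →L[ℝ] (Fin k → EuclideanSpace ℝ (Fin d)) :=
    ContinuousLinearMap.pi fun i => ContinuousLinearMap.proj (Sum.inl i)
  let L₂ : (Fin k ⊕ Fin l → EuclideanSpace ℝ (Fin d)) →L[ℝ] (Fin l → EuclideanSpace ℝ (Fin d)) :=
    ContinuousLinearMap.pi fun i => ContinuousLinearMap.proj (Sum.inr i)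
  exact ⟨Fin k ⊕ Fin l, inferInstance, Sum.elim s t, f ∘ L₁, g ∘ L₂,
    hf.comp L₁.hasTemperateGrowth, hg.comp L₂.hasTemperateGrowth, rfl, rfl⟩

theorem mul_mem_cylinderFunctions {F G : PathSpace d → ℝ} (hF : F ∈ cylinderFunctions d)
    (hG : G ∈ cylinderFunctions d) : F * G ∈ cylinderFunctions d := by
  obtain ⟨ι, _, s, f, g, hf, hg, rfl, rfl⟩ := exists_comp_eval₂ hF hG
  exact comp_eval_mem_cylinderFunctions s (hf.mul hg)

theorem comp_mem_cylinderFunctions {F : PathSpace d → ℝ} (hF : F ∈ cylinderFunctions d)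
    {η : ℝ → ℝ} (hη : η.HasTemperateGrowth) : η ∘ F ∈ cylinderFunctions d := by
  obtain ⟨k, s, f, hf, rfl⟩ := exists_comp_eval hF
  exact comp_eval_mem_cylinderFunctions s (hη.comp hf)

theorem const_mem_cylinderFunctions (c : ℝ) : (fun _ => c) ∈ cylinderFunctions d :=
  comp_eval_mem_cylinderFunctions (d := d) (fun i : Empty => i.elim)
    (Function.HasTemperateGrowth.const c)

theorem inner_eval_mem_cylinderFunctions (e : EuclideanSpace ℝ (Fin d)) (t : I) :
    (fun γ : PathSpace d => inner ℝ (γ t) e) ∈ cylinderFunctions d :=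
  comp_eval_mem_cylinderFunctions (d := d) (fun _ : Unit => t)
    ((Function.hasTemperateGrowth_inner_left e).comp
      (ContinuousLinearMap.proj (R := ℝ) (φ := fun _ : Unit => EuclideanSpace ℝ (Fin d))
        ()).hasTemperateGrowth)

variable (d) in
/-- The cylindrical functions as a linear space. -/
def cylinderSubmodule : Submodule ℝ (PathSpace d → ℝ) where
  carrier := cylinderFunctions d
  add_mem' {F G} hF hG := by
    obtain ⟨ι, _, s, f, g, hf, hg, rfl, rfl⟩ := exists_comp_eval₂ hF hG
    exact comp_eval_mem_cylinderFunctions s (hf.add hg)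
  zero_mem' := const_mem_cylinderFunctions 0
  smul_mem' c F hF := mul_mem_cylinderFunctions (const_mem_cylinderFunctions c) hF

theorem measurable_eval (s : I) : Measurable (fun γ : PathSpace d => γ s) :=
  (measurable_pi_apply s).comp (comap_measurable _)

theorem measurable_of_mem_cylinderFunctions {F : PathSpace d → ℝ} (hF : F ∈ cylinderFunctions d) :
    Measurable F := by
  obtain ⟨k, s, f, hf, rfl⟩ := exists_comp_eval hF
  exact hf.1.continuous.measurable.comp (measurable_pi_lambda _ fun i => measurable_eval (s i))

end CylinderAlgebra

/-! ### Schauder functions and directional derivatives -/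

section Schauder

theorem intervalIntegral_indicator_Iio {b s : ℝ} (hb : 0 ≤ b) (hs : 0 ≤ s) :
    ∫ u in (0 : ℝ)..s, (Iio b).indicator (fun _ => (1 : ℝ)) u = min s b := by
  rw [intervalIntegral.integral_of_le hs]
  have h : (Iio b).indicator (fun _ => (1 : ℝ)) =ᵐ[volume.restrict (Ioc 0 s)]
      (Iic b).indicator (fun _ => (1 : ℝ)) :=
    ae_restrict_of_ae (indicator_ae_eq_of_ae_eq_set Iio_ae_eq_Iic)
  rw [integral_congr_ae h, integral_indicator measurableSet_Iic,
    Measure.restrict_restrict measurableSet_Iic, inter_comm, Ioc_inter_Iic]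
  simp [hs, hb]

theorem intervalIntegrable_indicator_Iio (b s t : ℝ) :
    IntervalIntegrable ((Iio b).indicator (fun _ => (1 : ℝ))) volume s t :=
  ⟨(integrable_const _).indicator measurableSet_Iio, (integrable_const _).indicator measurableSet_Iio⟩

theorem hasDerivAt_min_const {x t : ℝ} (h : x ≠ t) :
    HasDerivAt (fun x => min x t) ((Iio t).indicator (fun _ => (1 : ℝ)) x) x := by
  rcases lt_or_gt_of_ne h with h | h
  · rw [indicator_of_mem (show x ∈ Iio t from h)]
    refine (hasDerivAt_id x).congr_of_eventuallyEq ?_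
    filter_upwards [Iio_mem_nhds h] with y hy using min_eq_left (le_of_lt hy)
  · rw [indicator_of_notMem (show x ∉ Iio t from not_lt.2 h.le)]
    refine (hasDerivAt_const x t).congr_of_eventuallyEq ?_
    filter_upwards [Ioi_mem_nhds h] with y hy using min_eq_right (le_of_lt hy)

/-- The left end point, the middle and the right end point of the support of a Haar function. -/
def haarKnot (n : ℕ) (l : ℕ) : ℝ := (2 * ((n : ℝ) - 2 ^ Nat.log 2 n) + l) / 2 ^ (Nat.log 2 n + 1)

theorem haarKnot_nonneg {n : ℕ} (hn : n ≠ 0) (l : ℕ) : 0 ≤ haarKnot n l := by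
  have h : (2 : ℝ) ^ Nat.log 2 n ≤ n := by exact_mod_cast Nat.pow_log_le_self 2 hn
  have hl : (0 : ℝ) ≤ l := Nat.cast_nonneg l
  exact div_nonneg (by linarith) (by positivity)

theorem haarKnot_le_one (n : ℕ) {l : ℕ} (hl : l ≤ 2) : haarKnot n l ≤ 1 := by
  have h : (n : ℝ) + 1 ≤ 2 ^ (Nat.log 2 n + 1) := by
    exact_mod_cast Nat.lt_pow_succ_log_self one_lt_two n
  have hl : (l : ℝ) ≤ 2 := by exact_mod_cast hl
  rw [haarKnot, div_le_one (by positivity)]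
  rw [pow_succ] at *
  linarith

theorem haarKnot_mono (n : ℕ) : Monotone (haarKnot n) := by
  intro k l hkl
  have : (k : ℝ) ≤ l := by exact_mod_cast hkl
  unfold haarKnot
  gcongr

/-- Indicators of half-lines are used because their primitives on `[0, ∞)` are the functions `r ↦ r
∧ t`, the directions in which the cylindrical gradient is computed. -/
theorem haar_eq_indicator {n : ℕ} (hn : n ≠ 0) (t : ℝ) :
    haar n t = √(2 ^ Nat.log 2 n) * (2 * (Iio (haarKnot n 1)).indicator (fun _ => (1 : ℝ)) t -
      (Iio (haarKnot n 0)).indicator (fun _ => (1 : ℝ)) t -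
      (Iio (haarKnot n 2)).indicator (fun _ => (1 : ℝ)) t) := by
  have h01 : haarKnot n 0 ≤ haarKnot n 1 := haarKnot_mono n (by norm_num)
  have h12 : haarKnot n 1 ≤ haarKnot n 2 := haarKnot_mono n (by norm_num)
  have h0 : ((n : ℝ) + 1 - 2 ^ Nat.log 2 n - 1) / 2 ^ Nat.log 2 n = haarKnot n 0 := by
    rw [haarKnot, pow_succ]; field_simp; push_cast; ring
  have h1 : (2 * ((n : ℝ) + 1 - 2 ^ Nat.log 2 n) - 1) / 2 ^ (Nat.log 2 n + 1) = haarKnot n 1 := by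
    rw [haarKnot]; push_cast; ring
  have h2 : ((n : ℝ) + 1 - 2 ^ Nat.log 2 n) / 2 ^ Nat.log 2 n = haarKnot n 2 := by
    rw [haarKnot, pow_succ]; field_simp; push_cast; ring
  simp only [haar, hn, if_false, h0, h1, h2, indicator, mem_Iio]
  rcases lt_or_ge t (haarKnot n 0) with ha | ha
  · have hb := ha.trans_le h01
    have hc := hb.trans_le h12
    simp [ha, hb, hc, ha.not_ge, hb.not_ge]
    norm_num
  · rcases lt_or_ge t (haarKnot n 1) with hb | hb
    · have hc := hb.trans_le h12
      simp [ha.not_gt, hb, hc, ha]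
      norm_num
    · rcases lt_or_ge t (haarKnot n 2) with hc | hc
      · simp [ha.not_gt, hb.not_gt, hc, hb]
      · simp [ha.not_gt, hb.not_gt, hc.not_gt]

theorem integral_haar {n : ℕ} (hn : n ≠ 0) {s : ℝ} (hs : 0 ≤ s) :
    ∫ u in (0 : ℝ)..s, haar n u = √(2 ^ Nat.log 2 n) *
      (2 * min s (haarKnot n 1) - min s (haarKnot n 0) - min s (haarKnot n 2)) := by
  have hi := fun l => intervalIntegrable_indicator_Iio (haarKnot n l) 0 s
  simp_rw [haar_eq_indicator hn]
  rw [intervalIntegral.integral_const_mul, intervalIntegral.integral_sub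
    (((hi 1).const_mul 2).sub (hi 0)) (hi 2), intervalIntegral.integral_sub
    ((hi 1).const_mul 2) (hi 0), intervalIntegral.integral_const_mul]
  simp only [intervalIntegral_indicator_Iio (haarKnot_nonneg hn _) hs]

variable {d : ℕ}

theorem schauder_eq (hd : 0 < d) (n : ℕ) (s : ℝ) :
    schauder d n s = (∫ u in (0 : ℝ)..s, haar (n / d) u) •
      EuclideanSpace.single (⟨n % d, Nat.mod_lt n hd⟩ : Fin d) (1 : ℝ) := by
  have h : haarVec d n = fun t => haar (n / d) t •
      EuclideanSpace.single (⟨n % d, Nat.mod_lt n hd⟩ : Fin d) (1 : ℝ) := by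
    ext t j
    simp [haarVec, Fin.ext_iff]
  rw [schauder, h, intervalIntegral.integral_smul_const]

/-- Schauder functions are linear combinations of the functions `r ↦ r ∧ t`. -/
theorem exists_schauder_eq_sum (hd : 0 < d) (n : ℕ) :
    ∃ (k : ℕ) (a : Fin k → ℝ) (t : Fin k → I) (e : EuclideanSpace ℝ (Fin d)),
      ∀ s : ℝ, 0 ≤ s → s ≤ 1 → schauder d n s = ∑ l, (a l * min s (t l)) • e := by
  by_cases hn : n / d = 0
  · refine ⟨1, fun _ => 1, fun _ => 1,
      EuclideanSpace.single (⟨n % d, Nat.mod_lt n hd⟩ : Fin d) (1 : ℝ), fun s _ hs1 => ?_⟩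
    rw [schauder_eq hd, hn]
    simp [haar, hs1]
  · refine ⟨3, ![-√(2 ^ Nat.log 2 (n / d)), 2 * √(2 ^ Nat.log 2 (n / d)),
        -√(2 ^ Nat.log 2 (n / d))],
      fun l => ⟨haarKnot (n / d) l, haarKnot_nonneg hn l, haarKnot_le_one _ (by omega)⟩,
      EuclideanSpace.single (⟨n % d, Nat.mod_lt n hd⟩ : Fin d) (1 : ℝ), fun s hs0 _ => ?_⟩
    rw [schauder_eq hd, integral_haar hn hs0, ← Finset.sum_smul]
    congr 1
    simp [Fin.sum_univ_three]
    ring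

/-- The Cameron–Martin product with a linear combination of the functions `r ↦ r ∧ sᵢ`. -/
theorem cmInner_sum_min {ι : Type*} [Fintype ι] {k : ℕ} {a : Fin k → ℝ} {t : Fin k → I}
    {e : EuclideanSpace ℝ (Fin d)} {h : ℝ → EuclideanSpace ℝ (Fin d)}
    (hh : ∀ s : ℝ, 0 ≤ s → s ≤ 1 → h s = ∑ l, (a l * min s (t l)) • e)
    (s : ι → I) (b : ι → EuclideanSpace ℝ (Fin d)) :
    cmInner h (fun x => ∑ i, min (s i : ℝ) x • b i) = ∑ i, inner ℝ (h (s i)) (b i) := by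
  have hder : ∀ᵐ x : ℝ, x ∈ Ioc (0 : ℝ) 1 → inner ℝ (deriv h x)
      (deriv (fun x => ∑ i, min (s i : ℝ) x • b i) x) =
      ∑ i, ∑ l, (a l * inner ℝ e (b i)) *
        (Iio (min (t l : ℝ) (s i))).indicator (fun _ => (1 : ℝ)) x := by
    -- Off the knots both functions are differentiable. The point `1` is excluded too, as `h` is
    -- only known on `[0, 1]` and its derivative needs a neighbourhood.
    have hfin : (range (fun l => (t l : ℝ)) ∪ range (fun i => (s i : ℝ)) ∪ {1}).Finite :=
      ((finite_range _).union (finite_range _)).union (finite_singleton _)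
    filter_upwards [hfin.countable.ae_notMem volume] with x hx hx01
    have hxt : ∀ l, x ≠ t l := fun l hl => hx (Or.inl (Or.inl ⟨l, hl.symm⟩))
    have hxs : ∀ i, x ≠ s i := fun l hl => hx (Or.inl (Or.inr ⟨l, hl.symm⟩))
    have hx1 : x < 1 := lt_of_le_of_ne hx01.2 fun h1 => hx (Or.inr h1)
    have h1 : HasDerivAt h (∑ l, (a l * (Iio (t l : ℝ)).indicator (fun _ => (1 : ℝ)) x) • e) x := by
      have : HasDerivAt (fun x : ℝ => ∑ l, (a l * min x (t l : ℝ)) • e)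
          (∑ l, (a l * (Iio (t l : ℝ)).indicator (fun _ => (1 : ℝ)) x) • e) x :=
        HasDerivAt.fun_sum fun l _ => ((hasDerivAt_min_const (hxt l)).const_mul (a l)).smul_const e
      refine this.congr_of_eventuallyEq ?_
      filter_upwards [Ioo_mem_nhds hx01.1 hx1] with y hy using hh y hy.1.le hy.2.le
    have h2 : HasDerivAt (fun x => ∑ i, min (s i : ℝ) x • b i)
        (∑ i, (Iio (s i : ℝ)).indicator (fun _ => (1 : ℝ)) x • b i) x :=
      HasDerivAt.fun_sum fun i _ => by
        simpa only [min_comm] using (hasDerivAt_min_const (hxs i)).smul_const (b i)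
    rw [h1.deriv, h2.deriv, inner_sum]
    refine Finset.sum_congr rfl fun i _ => ?_
    rw [sum_inner]
    refine Finset.sum_congr rfl fun l _ => ?_
    rw [inner_smul_left, inner_smul_right]
    simp only [indicator, mem_Iio, lt_min_iff, conj_trivial]
    split_ifs <;> simp_all
  rw [cmInner, intervalIntegral.integral_congr_ae
    (g := fun x => ∑ i, ∑ l, (a l * inner ℝ e (b i)) *
        (Iio (min (t l : ℝ) (s i))).indicator (fun _ => (1 : ℝ)) x)
    (by simpa [uIoc_of_le] using hder)]
  have hint : ∀ i l, IntervalIntegrable (fun x => (a l * inner ℝ e (b i)) *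
        (Iio (min (t l : ℝ) (s i))).indicator (fun _ => (1 : ℝ)) x) volume 0 1 :=
    fun i l => (intervalIntegrable_indicator_Iio _ 0 1).const_mul _
  rw [intervalIntegral.integral_finsetSum fun i _ => by
    simpa [Finset.sum_fn] using IntervalIntegrable.sum Finset.univ fun l _ => hint i l]
  refine Finset.sum_congr rfl fun i _ => ?_
  rw [intervalIntegral.integral_finsetSum fun l _ => hint i l, hh _ (s i).2.1 (s i).2.2, sum_inner]
  refine Finset.sum_congr rfl fun l _ => ?_
  have hm : 0 ≤ min (t l : ℝ) (s i) := le_min (t l).2.1 (s i).2.1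
  rw [intervalIntegral.integral_const_mul, intervalIntegral_indicator_Iio hm zero_le_one,
    inner_smul_left, min_eq_right (min_le_of_left_le (t l).2.2), min_comm]
  simp
  ring

/-- `⟨D_t F, e⟩` in terms of an arbitrary representation of `F`. -/
theorem inner_grad_eq_fderiv {ι : Type*} [Fintype ι] (s : ι → I)
    {f : (ι → EuclideanSpace ℝ (Fin d)) → ℝ} (hf : f.HasTemperateGrowth) (Φ : CylinderData d)
    (hΦ : Φ.toFun = fun γ => f (fun i => γ (s i))) (γ : PathSpace d) (t : I)
    (e : EuclideanSpace ℝ (Fin d)) :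
    inner ℝ (Φ.grad γ t) e =
      fderiv ℝ f (fun i => γ (s i)) (fun i => min (s i : ℝ) t • e) := by
  -- Both sides are the derivative at `0` of `F` along the path shifted in the direction `r ↦ (r ∧
  -- t) e`, computed from two representations of `F`.
  have h1 := Φ.hasDerivAt_shift γ e t t.2.1
  have hline : HasDerivAt (fun r : ℝ => (fun i => γ (s i)) + r • (fun i => min (s i : ℝ) t • e))
      (fun i => min (s i : ℝ) t • e) 0 := by
    simpa using ((hasDerivAt_id (0 : ℝ)).smul_const
      (fun i : ι => min (s i : ℝ) t • e)).const_add (fun i => γ (s i))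
  have h0 : HasFDerivAt f (fderiv ℝ f (fun i => γ (s i)))
      ((fun i => γ (s i)) + (0 : ℝ) • (fun i => min (s i : ℝ) t • e)) := by
    simpa using (hf.differentiable _).hasFDerivAt
  have h2 := h0.comp_hasDerivAt (0 : ℝ) hline
  rw [hΦ] at h1
  exact h1.unique h2

/-- `⟨Sₙ, DF⟩` is the derivative of `F` in the direction `Sₙ`. -/
theorem cmInner_schauder_cylinderGradient (hd : 0 < d) {ι : Type*} [Fintype ι] (s : ι → I)
    {f : (ι → EuclideanSpace ℝ (Fin d)) → ℝ} (hf : f.HasTemperateGrowth) (n : ℕ)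
    (γ : PathSpace d) :
    cmInner (schauder d n) (cylinderGradient (fun γ => f (fun i => γ (s i))) γ) =
      fderiv ℝ f (fun i => γ (s i)) (fun i => schauder d n (s i)) := by
  have hmem : (fun γ : PathSpace d => f (fun i => γ (s i))) ∈ cylinderFunctions d :=
    comp_eval_mem_cylinderFunctions s hf
  rw [cylinderGradient, dif_pos hmem]
  set Φ := hmem.choose
  obtain ⟨k, a, t, e, h⟩ := exists_schauder_eq_sum hd n
  have h1 := cmInner_sum_min h Φ.s (fun i => Φ.partialGradient i γ)
  have h2 : cmInner (schauder d n) (Φ.grad γ) =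
      ∑ i, inner ℝ (schauder d n (Φ.s i)) (Φ.partialGradient i γ) := h1
  have h3 : (fun i => schauder d n (s i)) = ∑ l, a l • fun i => min (s i : ℝ) (t l) • e := by
    ext1 i
    simp [h _ (s i).2.1 (s i).2.2, mul_smul]
  rw [h2, h3, map_sum]
  simp_rw [map_smul, ← inner_grad_eq_fderiv s hf Φ hmem.choose_spec γ _ e, CylinderData.grad,
    sum_inner, h _ (Φ.s _).2.1 (Φ.s _).2.2, sum_inner, Finset.smul_sum]
  rw [Finset.sum_comm]
  refine Finset.sum_congr rfl fun l _ => Finset.sum_congr rfl fun i _ => ?_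
  rw [inner_smul_left, inner_smul_left, real_inner_comm]
  simp
  ring

end Schauder

/-! ### Gaussian integration by parts -/

section Stein

open scoped NNReal

theorem Function.HasTemperateGrowth.integrable_gaussianReal {g : ℝ → ℝ} (hg : g.HasTemperateGrowth)
    (m : ℝ) (v : ℝ≥0) : Integrable g (gaussianReal m v) := by
  obtain ⟨k, C, h⟩ := hg.2 0
  -- The growth exponent may be `0`, while the moment lemma needs a nonzero one.
  obtain ⟨p, hp, hkp⟩ : ∃ p : ℕ, p ≠ 0 ∧ k ≤ p := ⟨k + 1, k.succ_ne_zero, k.le_succ⟩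
  have h1 : MemLp (fun x : ℝ => 1 + ‖x‖) p (gaussianReal m v) := by
    have h2 : MemLp (fun _ : ℝ => (1 : ℝ)) p (gaussianReal m v) := memLp_const 1
    have h3 : MemLp (fun x : ℝ => x) p (gaussianReal m v) :=
      memLp_id_gaussianReal' p (ENNReal.natCast_ne_top p)
    exact h2.add h3.norm
  have h4 := (h1.integrable_norm_pow hp).const_mul |C|
  refine h4.mono' hg.1.continuous.aestronglyMeasurable (ae_of_all _ fun x => ?_)
  have h2 := h x
  rw [norm_iteratedFDeriv_zero] at h2
  have h3 : (1 : ℝ) ≤ 1 + ‖x‖ := by simp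
  calc ‖g x‖ ≤ C * (1 + ‖x‖) ^ k := h2
    _ ≤ |C| * (1 + ‖x‖) ^ p := by
        gcongr
        · exact le_abs_self C
    _ = |C| * ‖1 + ‖x‖‖ ^ p := by rw [Real.norm_of_nonneg (by positivity : 0 ≤ 1 + ‖x‖)]

theorem hasDerivAt_gaussianPDFReal (v : ℝ≥0) (x : ℝ) :
    HasDerivAt (gaussianPDFReal 0 v) (-(x / v) * gaussianPDFReal 0 v x) x := by
  have h1 : HasDerivAt (fun x : ℝ => -(x - 0) ^ 2 / (2 * v)) (-(x / v)) x := by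
    have := (((hasDerivAt_id x).sub_const 0).pow 2).neg.div_const (2 * (v : ℝ))
    refine this.congr_deriv ?_
    simp only [id]
    rcases eq_or_ne (v : ℝ) 0 with hv | hv
    · simp [hv]
    · field_simp
      simp [mul_comm]
  refine (h1.exp.const_mul _).congr_deriv ?_
  rw [gaussianPDFReal]
  ring

/-- Stein's identity. -/
theorem integral_mul_gaussianReal {g : ℝ → ℝ} (hg : g.HasTemperateGrowth) {v : ℝ≥0} (hv : v ≠ 0) :
    ∫ x, g x * x ∂(gaussianReal 0 v) = v * ∫ x, deriv g x ∂(gaussianReal 0 v) := by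
  have hint : ∀ f : ℝ → ℝ, f.HasTemperateGrowth →
      Integrable (fun x => gaussianPDFReal 0 v x * f x) := by
    intro f hf
    have h := hf.integrable_gaussianReal 0 v
    rw [gaussianReal_of_var_ne_zero _ hv, integrable_withDensity_iff_integrable_smul₀'
      (measurable_gaussianPDF 0 v).aemeasurable (ae_of_all _ fun _ => gaussianPDF_lt_top)] at h
    simpa [toReal_gaussianPDF] using h
  have hdg : (deriv g).HasTemperateGrowth := by
    have : deriv g = fun x => fderiv ℝ g x 1 := by ext; simp
    rw [this]
    exact hg.fderiv_apply 1
  have hgx : (fun x => g x * x).HasTemperateGrowth := hg.mul .id'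
  have hv' : (v : ℝ) ≠ 0 := by exact_mod_cast hv
  have h := integral_mul_deriv_eq_deriv_mul_of_integrable (u := g) (v := gaussianPDFReal 0 v)
    (u' := deriv g) (v' := fun x => -(x / v) * gaussianPDFReal 0 v x)
    (fun x _ => (hg.differentiable x).hasDerivAt) (fun x _ => hasDerivAt_gaussianPDFReal v x)
    (((hint _ hgx).const_mul (-(v : ℝ)⁻¹)).congr (ae_of_all _ fun x => by
      simp only [Pi.mul_apply]; ring))
    ((hint _ hdg).congr (ae_of_all _ fun x => by simp only [Pi.mul_apply]; ring))
    ((hint _ hg).congr (ae_of_all _ fun x => by simp only [Pi.mul_apply]; ring))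
  rw [integral_gaussianReal_eq_integral_smul hv, integral_gaussianReal_eq_integral_smul hv]
  have h1 : ∫ x, gaussianPDFReal 0 v x • (g x * x) =
      -v * ∫ x, g x * (-(x / v) * gaussianPDFReal 0 v x) := by
    rw [← integral_const_mul]
    congr 1
    ext x
    simp only [smul_eq_mul]
    field_simp
  rw [h1, h]
  simp only [smul_eq_mul, mul_comm (deriv g _)]
  ring

/-- Integration by parts for a random vector `U + Y c` with `U` and `Y` independent and `Y`
centred Gaussian. -/
theorem integral_mul_eq_integral_fderiv {Ω V : Type*} [MeasurableSpace Ω] {P : Measure Ω}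
    [IsProbabilityMeasure P] [NormedAddCommGroup V] [NormedSpace ℝ V] [MeasurableSpace V]
    [BorelSpace V] [SecondCountableTopology V] {U : Ω → V} {Y : Ω → ℝ} {c : V}
    (hU : Measurable U) (hY : Measurable Y) (hUY : IndepFun U Y P) {v : ℝ≥0} (hv : v ≠ 0)
    (hlaw : P.map Y = gaussianReal 0 v) {f : V → ℝ} (hf : f.HasTemperateGrowth)
    (hi₁ : Integrable (fun ω => f (U ω + Y ω • c) * Y ω) P)
    (hi₂ : Integrable (fun ω => fderiv ℝ f (U ω + Y ω • c) c) P) :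
    ∫ ω, f (U ω + Y ω • c) * Y ω ∂P = v * ∫ ω, fderiv ℝ f (U ω + Y ω • c) c ∂P := by
  have hprod := (indepFun_iff_map_prod_eq_prod_map_map hU.aemeasurable hY.aemeasurable).1 hUY
  rw [hlaw] at hprod
  have hUYm : Measurable fun ω => (U ω, Y ω) := hU.prodMk hY
  have := hf.1.continuous
  have := hf.fderiv_apply c |>.1.continuous
  have hm₁ : Continuous (fun p : V × ℝ => f (p.1 + p.2 • c) * p.2) := by fun_prop
  have hm₂ : Continuous (fun p : V × ℝ => fderiv ℝ f (p.1 + p.2 • c) c) := by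
    have h3 : Continuous (fun p : V × ℝ => p.1 + p.2 • c) := by fun_prop
    exact (hf.fderiv_apply c).1.continuous.comp h3
  have hj₁ := (integrable_map_measure hm₁.aestronglyMeasurable hUYm.aemeasurable).2 hi₁
  have hj₂ := (integrable_map_measure hm₂.aestronglyMeasurable hUYm.aemeasurable).2 hi₂
  rw [← integral_map (f := fun p : V × ℝ => f (p.1 + p.2 • c) * p.2) hUYm.aemeasurable
      hm₁.aestronglyMeasurable,
    ← integral_map (f := fun p : V × ℝ => fderiv ℝ f (p.1 + p.2 • c) c) hUYm.aemeasurable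
      hm₂.aestronglyMeasurable]
  rw [hprod] at hj₁ hj₂ ⊢
  have := Measure.isProbabilityMeasure_map (μ := P) hU.aemeasurable
  -- By Fubini it suffices to apply Stein's identity on each line `u + ℝ c`.
  rw [integral_prod _ hj₁, integral_prod _ hj₂, ← integral_const_mul]
  congr 1
  ext u
  have hline : (fun y : ℝ => u + y • c).HasTemperateGrowth :=
    (Function.HasTemperateGrowth.const u).add
      ((ContinuousLinearMap.id ℝ ℝ).smulRight c).hasTemperateGrowth
  have hder : ∀ y : ℝ, deriv (fun y : ℝ => f (u + y • c)) y = fderiv ℝ f (u + y • c) c := by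
    intro y
    have h1 : HasDerivAt (fun y : ℝ => u + y • c) c y := by
      simpa using ((hasDerivAt_id y).smul_const c).const_add u
    exact ((hf.differentiable _).hasFDerivAt.comp_hasDerivAt y h1).deriv
  have h := integral_mul_gaussianReal (hf.comp hline) hv
  simp only [Function.comp_def, hder] at h
  exact h

end Stein

/-! ### Gaussian structure of Wiener measure and integration by parts on path space -/

section Wiener

variable {d : ℕ} {ν : Measure (PathSpace d)}

theorem IsWienerMeasure.map_eval (hν : IsWienerMeasure ν) (t : I) :
    ν.map (fun γ : PathSpace d => γ t) =
      multivariateGaussian 0 ((t : ℝ) • (1 : Matrix (Fin d) (Fin d) ℝ)) := by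
  have h := hν.map_increment 0 t unitInterval.nonneg'
  simpa [PathSpace, Subtype.prop, fun γ : PathSpace d => γ.2] using h

theorem IsWienerMeasure.hasGaussianLaw_eval (hν : IsWienerMeasure ν) (t : I) :
    HasGaussianLaw (fun γ : PathSpace d => γ t) ν where
  isGaussian_map := by
    rw [hν.map_eval]
    infer_instance

theorem IsWienerMeasure.isGaussianProcess (hν : IsWienerMeasure ν) :
    IsGaussianProcess (fun (t : I) (γ : PathSpace d) => γ t) ν :=
  hν.hasIndepIncrements.isGaussianProcess hν.hasGaussianLaw_eval (ae_of_all _ fun γ => γ.2)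

theorem IsWienerMeasure.memLp_inner (hν : IsWienerMeasure ν) (t : I)
    (x : EuclideanSpace ℝ (Fin d)) :
    MemLp (fun γ : PathSpace d => inner ℝ x (γ t)) 2 ν := by
  have := hν.isProbabilityMeasure
  exact (hν.hasGaussianLaw_eval t).memLp_two.const_inner x

theorem IsWienerMeasure.covariance_inner_self (hν : IsWienerMeasure ν) (t : I)
    (x y : EuclideanSpace ℝ (Fin d)) :
    cov[fun γ : PathSpace d => inner ℝ x (γ t), fun γ : PathSpace d => inner ℝ y (γ t); ν] =
      t * inner ℝ x y := by
  have := hν.isProbabilityMeasure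
  have hS : ((t : ℝ) • (1 : Matrix (Fin d) (Fin d) ℝ)).PosSemidef :=
    Matrix.PosSemidef.one.smul t.2.1
  rw [← covariance_map_fun (X := fun u => inner ℝ x u) (Y := fun u => inner ℝ y u)
    (Z := fun γ : PathSpace d => γ t) (by fun_prop) (by fun_prop) (measurable_eval t).aemeasurable,
    hν.map_eval, ← covarianceBilin_apply_eq_cov IsGaussian.memLp_two_id,
    covarianceBilin_multivariateGaussian hS]
  simp only [Matrix.smul_mulVec, Matrix.one_mulVec, dotProduct, PiLp.inner_apply, Pi.smul_apply,
    Finset.mul_sum]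
  refine Finset.sum_congr rfl fun i _ => ?_
  simp
  ring

theorem IsWienerMeasure.covariance_inner (hν : IsWienerMeasure ν) (s t : I)
    (x y : EuclideanSpace ℝ (Fin d)) :
    cov[fun γ : PathSpace d => inner ℝ x (γ s), fun γ : PathSpace d => inner ℝ y (γ t); ν] =
      min (s : ℝ) t * inner ℝ x y := by
  have := hν.isProbabilityMeasure
  wlog hst : s ≤ t generalizing s t x y
  · rw [covariance_comm, this t s y x (le_of_not_ge hst), min_comm, real_inner_comm]
  have hind := hν.hasIndepIncrements.indepFun_eval_sub (r := 0) (unitInterval.nonneg') hst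
    (ae_of_all _ fun γ => γ.2)
  have hind' : IndepFun (fun γ : PathSpace d => inner ℝ x (γ s))
      (fun γ : PathSpace d => inner ℝ y (γ t - γ s)) ν :=
    hind.comp (φ := fun u => inner ℝ x u) (ψ := fun u => inner ℝ y u)
      (by fun_prop) (by fun_prop)
  have hsub : MemLp (fun γ : PathSpace d => inner ℝ y (γ t - γ s)) 2 ν := by
    simp_rw [inner_sub_right]
    exact (hν.memLp_inner t y).sub (hν.memLp_inner s y)
  have hdec : (fun γ : PathSpace d => inner ℝ y (γ t)) =
      (fun γ : PathSpace d => inner ℝ y (γ s)) + (fun γ : PathSpace d => inner ℝ y (γ t - γ s)) := by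
    ext γ
    simp [inner_sub_right]
  rw [hdec, covariance_add_right (hν.memLp_inner s x) (hν.memLp_inner s y) hsub,
    hind'.covariance_eq_zero (hν.memLp_inner s x) hsub, hν.covariance_inner_self, add_zero,
    min_eq_left (by exact_mod_cast hst)]

theorem IsWienerMeasure.map_inner (hν : IsWienerMeasure ν) (t : I)
    (e : EuclideanSpace ℝ (Fin d)) :
    ν.map (fun γ : PathSpace d => inner ℝ e (γ t)) =
      gaussianReal 0 (t * inner ℝ e e : ℝ).toNNReal := by
  have := hν.isProbabilityMeasure
  have h : HasGaussianLaw (fun γ : PathSpace d => inner ℝ e (γ t)) ν :=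
    (hν.hasGaussianLaw_eval t).map (innerSL ℝ e)
  have hmean : ∫ γ : PathSpace d, inner ℝ e (γ t) ∂ν = 0 := by
    rw [integral_inner (hν.hasGaussianLaw_eval t).integrable]
    have := integral_map (μ := ν) (φ := fun γ : PathSpace d => γ t) (f := fun x => x)
      (measurable_eval t).aemeasurable (by fun_prop)
    rw [← this, hν.map_eval]
    simp
  rw [h.map_eq_gaussianReal, hmean, ← covariance_self h.aemeasurable, hν.covariance_inner_self]

/-- The subtracted term is the regression of `γ(s_i)` on `⟨e, γ(t)⟩`: covariance `(s_i ∧ t) e`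
divided by the variance `t ⟨e, e⟩`. The residuals are uncorrelated with `⟨e, γ(t)⟩`, and joint
Gaussianity turns this into independence. -/
theorem IsWienerMeasure.indepFun_residual (hν : IsWienerMeasure ν) {ι : Type*} [Finite ι]
    (s : ι → I) (t : I) (e : EuclideanSpace ℝ (Fin d)) (ht : (t : ℝ) * inner ℝ e e ≠ 0) :
    IndepFun (fun (γ : PathSpace d) (i : ι) =>
        γ (s i) - (inner ℝ e (γ t) * (min (s i : ℝ) t / (t * inner ℝ e e))) • e)
      (fun γ : PathSpace d => inner ℝ e (γ t)) ν := by
  have := hν.isProbabilityMeasure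
  classical
  let X : ι → PathSpace d → EuclideanSpace ℝ (Fin d) := fun i γ =>
    γ (s i) - (inner ℝ e (γ t) * (min (s i : ℝ) t / (t * inner ℝ e e))) • e
  -- The scalar variable is carried by the vector `e`, so that it and the residuals form one
  -- Gaussian process with values in a single space. It is recovered at the end by pairing with `e`.
  let Y : Unit → PathSpace d → EuclideanSpace ℝ (Fin d) := fun _ γ => inner ℝ e (γ t) • e
  have hG : IsGaussianProcess (Sum.elim X Y) ν := by
    refine hν.isGaussianProcess.of_isGaussianProcess ?_
    rintro (i | i)
    · refine ⟨{s i, t}, ContinuousLinearMap.proj (⟨s i, by simp⟩ : ({s i, t} : Finset I)) -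
        (min (s i : ℝ) t / (t * inner ℝ e e)) • ((innerSL ℝ e).smulRight e).comp
          (ContinuousLinearMap.proj (R := ℝ) (φ := fun _ => EuclideanSpace ℝ (Fin d))
            (⟨t, by simp⟩ : ({s i, t} : Finset I))), fun γ => ?_⟩
      simp [X, smul_smul, mul_comm]
    · refine ⟨{t}, ((innerSL ℝ e).smulRight e).comp
          (ContinuousLinearMap.proj (R := ℝ) (φ := fun _ => EuclideanSpace ℝ (Fin d))
            (⟨t, by simp⟩ : ({t} : Finset I))), fun γ => ?_⟩
      simp [Y]
  have hYm : ∀ i, Measurable (Y i) := fun i =>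
    ((measurable_eval t).const_inner).smul_const e
  have hXm : ∀ i, Measurable (X i) := fun i =>
    (measurable_eval (s i)).sub (((measurable_eval t).const_inner.mul_const _).smul_const e)
  have hind := hG.indepFun_of_covariance_inner (fun i => (hXm i).aemeasurable)
    (fun i => (hYm i).aemeasurable) fun i j x y => by
      have h1 : (fun γ => inner ℝ x (X i γ)) = (fun γ : PathSpace d => inner ℝ x (γ (s i))) -
          fun γ : PathSpace d => (min (s i : ℝ) t / (t * inner ℝ e e) * inner ℝ x e) *
            inner ℝ e (γ t) := by
        ext γ
        simp only [X, inner_sub_right, inner_smul_right, Pi.sub_apply]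
        ring
      have h2 : (fun γ => inner ℝ y (Y j γ)) =
          fun γ : PathSpace d => inner ℝ y e * inner ℝ e (γ t) := by
        ext γ
        simp only [Y, inner_smul_right]
        ring
      rw [h1, h2, covariance_const_mul_right, covariance_sub_left (hν.memLp_inner _ _)
        ((hν.memLp_inner _ _).const_mul _) (hν.memLp_inner _ _), covariance_const_mul_left,
        hν.covariance_inner, hν.covariance_inner_self]
      have h3 : min (s i : ℝ) t / (t * inner ℝ e e) * inner ℝ x e * (t * inner ℝ e e) =
          min (s i : ℝ) t * inner ℝ x e := by
        rw [div_mul_eq_mul_div, div_mul_eq_mul_div, mul_div_cancel_right₀ _ ht]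
      rw [h3, sub_self, mul_zero]
  have he : (inner ℝ e e : ℝ) ≠ 0 := right_ne_zero_of_mul ht
  have hY : (fun γ : PathSpace d => inner ℝ e (γ t)) =
      (fun y : Unit → EuclideanSpace ℝ (Fin d) => inner ℝ e (y ()) / inner ℝ e e) ∘
        fun γ i => Y i γ := by
    ext γ
    simp only [Y, inner_smul_right, Function.comp_apply]
    rw [mul_div_cancel_right₀ _ he]
  rw [hY]
  exact hind.comp (φ := id) measurable_id ((measurable_pi_apply ()).const_inner.div_const _)

/-- Integration by parts on Wiener space in the direction `r ↦ (r ∧ t) e`. -/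
theorem IsWienerMeasure.integral_fderiv_min (hν : IsWienerMeasure ν)
    (hint : ∀ F ∈ cylinderFunctions d, Integrable F ν) {ι : Type*} [Fintype ι] (s : ι → I)
    {f : (ι → EuclideanSpace ℝ (Fin d)) → ℝ} (hf : f.HasTemperateGrowth) (t : I)
    (e : EuclideanSpace ℝ (Fin d)) :
    ∫ γ : PathSpace d, fderiv ℝ f (fun i => γ (s i)) (fun i => min (s i : ℝ) t • e) ∂ν =
      ∫ γ : PathSpace d, f (fun i => γ (s i)) * inner ℝ (γ t) e ∂ν := by
  have := hν.isProbabilityMeasure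
  -- In the degenerate case `t = 0` or `e = 0`, the direction and the factor `⟨γ(t), e⟩` both
  -- vanish.
  rcases eq_or_ne ((t : ℝ) * inner ℝ e e) 0 with h0 | h0
  · have ht : (t = 0) ∨ e = 0 := by
      rcases mul_eq_zero.1 h0 with h | h
      · exact Or.inl (Subtype.ext h)
      · exact Or.inr (inner_self_eq_zero.1 h)
    rcases ht with rfl | rfl
    · have h1 : ∀ i, min (s i : ℝ) ((0 : I) : ℝ) • e = 0 := fun i => by
        rw [min_eq_right (by exact (s i).2.1)]; simp
      have h2 : ∀ γ : PathSpace d, γ 0 = 0 := fun γ => γ.2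
      have h3 : (fun i => min (s i : ℝ) ((0 : I) : ℝ) • e) = 0 := funext h1
      simp_rw [h3, h2]
      simp
    · have h3 : (fun i => min (s i : ℝ) (t : ℝ) • (0 : EuclideanSpace ℝ (Fin d))) = 0 := by
        ext1 i; simp
      simp_rw [h3]
      simp
  · set r : ℝ := t * inner ℝ e e with hr
    have hrpos : 0 < r := lt_of_le_of_ne (mul_nonneg t.2.1 real_inner_self_nonneg) h0.symm
    -- `c` collects the regression coefficients. The variance `r` produced by Stein's identity
    -- cancels the denominator, since `r • c` is the direction of differentiation.
    set c : ι → EuclideanSpace ℝ (Fin d) := fun i => (min (s i : ℝ) t / r) • e with hc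
    have hsum : ∀ γ : PathSpace d, (fun i => γ (s i) -
        (inner ℝ e (γ t) * (min (s i : ℝ) t / r)) • e) + (inner ℝ e (γ t) : ℝ) • c =
        fun i => γ (s i) := by
      intro γ
      ext1 i
      simp [hc, smul_smul]
    have hF : ∀ c' : ι → EuclideanSpace ℝ (Fin d),
        Integrable (fun γ : PathSpace d => fderiv ℝ f (fun i => γ (s i)) c') ν := fun c' =>
      hint _ (comp_eval_mem_cylinderFunctions s (hf.fderiv_apply c'))
    have hG : Integrable (fun γ : PathSpace d => f (fun i => γ (s i)) * inner ℝ e (γ t)) ν := by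
      simp_rw [real_inner_comm _ e]
      exact hint _ (mul_mem_cylinderFunctions (comp_eval_mem_cylinderFunctions s hf)
        (inner_eval_mem_cylinderFunctions e t))
    have hU : Measurable (fun (γ : PathSpace d) (i : ι) =>
        γ (s i) - (inner ℝ e (γ t) * (min (s i : ℝ) t / r)) • e) :=
      measurable_pi_lambda _ fun i => (measurable_eval (s i)).sub
        (((measurable_eval t).const_inner.mul_const _).smul_const e)
    have h := integral_mul_eq_integral_fderiv (P := ν) (c := c) hU (measurable_eval t).const_inner
      (hν.indepFun_residual s t e h0) (v := r.toNNReal) (by simpa using hrpos) (hν.map_inner t e) hf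
      (by simpa only [hsum] using hG) (by simpa only [hsum] using hF c)
    simp only [hsum, Real.coe_toNNReal r hrpos.le] at h
    have hcs : (fun i => min (s i : ℝ) t • e) = r • c := by
      ext1 i
      simp only [hc, Pi.smul_apply, smul_smul]
      rw [mul_div_cancel₀ _ hrpos.ne']
    simp_rw [hcs, map_smul, smul_eq_mul, real_inner_comm e]
    rw [integral_const_mul, ← h]

/-- Integration by parts in the directions `Sₙ`, whose adjoint maps cylindrical functions to
cylindrical functions. -/
theorem IsWienerMeasure.exists_integral_cmInner_eq (hν : IsWienerMeasure ν) (hd : 0 < d)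
    (hint : ∀ F ∈ cylinderFunctions d, Integrable F ν) (n : ℕ) :
    ∃ W ∈ cylinderFunctions d, ∀ F ∈ cylinderFunctions d,
      ∫ γ, cmInner (schauder d n) (cylinderGradient F γ) ∂ν = ∫ γ, F γ * W γ ∂ν := by
  obtain ⟨k, a, t, e, h⟩ := exists_schauder_eq_sum hd n
  have hW : ∀ l, (a l • fun γ : PathSpace d => (inner ℝ (γ (t l)) e : ℝ)) ∈ cylinderSubmodule d :=
    fun l => Submodule.smul_mem _ _ (inner_eval_mem_cylinderFunctions e (t l))
  -- This weight is the Wiener integral of `g_{n+1}`, a finite sum because the integrand is a step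
  -- function.
  refine ⟨∑ l, a l • fun γ => inner ℝ (γ (t l)) e,
    Submodule.sum_mem (cylinderSubmodule d) fun l _ => hW l, fun F hF => ?_⟩
  obtain ⟨m, s, f, hf, rfl⟩ := exists_comp_eval hF
  have h3 : (fun i => schauder d n (s i)) = ∑ l, a l • fun i => min (s i : ℝ) (t l) • e := by
    ext1 i
    simp [h _ (s i).2.1 (s i).2.2, mul_smul]
  simp_rw [cmInner_schauder_cylinderGradient hd s hf, h3, map_sum, map_smul, Finset.sum_apply,
    Finset.mul_sum, Pi.smul_apply, smul_eq_mul]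
  rw [integral_finsetSum, integral_finsetSum]
  · refine Finset.sum_congr rfl fun l _ => ?_
    rw [integral_const_mul, hν.integral_fderiv_min hint s hf (t l) e, ← integral_const_mul]
    congr 1
    ext γ
    ring
  · exact fun l _ => hint _ (mul_mem_cylinderFunctions hF (hW l))
  · exact fun l _ => (hint _ (comp_eval_mem_cylinderFunctions s (hf.fderiv_apply _))).const_mul _

end Wiener

/-! ### Cylindrical functions determine measures -/

section Uniqueness

variable {d : ℕ}

/-- The σ-algebra of path space is generated by the evaluations at a dense set of times. -/
theorem measurableSpace_eq_comap_of_dense {D : Set I} (hD : Dense D) :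
    (inferInstance : MeasurableSpace (PathSpace d)) =
      MeasurableSpace.comap (fun (γ : PathSpace d) (s : D) => γ s) MeasurableSpace.pi := by
  refine le_antisymm ?_ ?_
  · refine Measurable.comap_le (@measurable_pi_lambda _ _ _ (_) _ _ fun s => ?_)
    -- By continuity of paths, the evaluation at `s` is a pointwise limit of evaluations at times of
    -- `D`.
    obtain ⟨u, huD, hu⟩ := mem_closure_iff_seq_limit.1 (hD s)
    have hm : ∀ n, Measurable[MeasurableSpace.comap
        (fun (γ : PathSpace d) (s : D) => γ s) MeasurableSpace.pi]
        (fun γ : PathSpace d => γ (u n)) := fun n =>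
      (measurable_pi_apply (X := fun _ : D => EuclideanSpace ℝ (Fin d)) ⟨u n, huD n⟩).comp
        (comap_measurable (fun (γ : PathSpace d) (s : D) => γ s))
    refine @measurable_of_tendsto_metrizable _ _ (_) _ _ _ _ _ _ hm (tendsto_pi_nhds.2 fun γ => ?_)
    exact (γ.1.continuous.tendsto s).comp hu
  · exact Measurable.comap_le (measurable_pi_lambda _ fun s => measurable_eval (s : I))

theorem measure_ext_of_finite_dimensional {D : Set I} (hD : Dense D)
    {μ₁ μ₂ : Measure (PathSpace d)} [IsFiniteMeasure μ₁] [IsFiniteMeasure μ₂]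
    (h : ∀ J : Finset D, μ₁.map (fun γ (j : J) => γ (j : D)) = μ₂.map (fun γ (j : J) => γ (j : D))) :
    μ₁ = μ₂ := by
  set ev : PathSpace d → D → EuclideanSpace ℝ (Fin d) := fun γ s => γ s
  have hev : Measurable ev := measurable_pi_lambda _ fun s => measurable_eval (s : I)
  have hlim : ∀ μ : Measure (PathSpace d), ∀ J : Finset D,
      (μ.map ev).map J.restrict = μ.map (fun γ (j : J) => γ (j : D)) := fun μ J =>
    Measure.map_map (Finset.measurable_restrict J) hev
  have hlim₁ : IsProjectiveLimit (μ₁.map ev) (fun J : Finset D => (μ₂.map ev).map J.restrict) :=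
    fun J => ((hlim μ₁ J).trans (h J)).trans (hlim μ₂ J).symm
  have hlim₂ : IsProjectiveLimit (μ₂.map ev) (fun J : Finset D => (μ₂.map ev).map J.restrict) :=
    fun J => rfl
  have heq : μ₁.map ev = μ₂.map ev := hlim₁.unique hlim₂
  ext A hA
  obtain ⟨B, hB, rfl⟩ := (measurableSpace_eq_comap_of_dense hD).le A hA
  have := congrArg (fun μ => μ B) heq
  simpa only [Measure.map_apply hev hB] using this

/-- The measures with densities `ψ⁺` and `ψ⁻` have the same finite-dimensional characteristic
functions: cosine and sine of a linear functional are bounded and of temperate growth, hence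
admissible tests. So the measures agree, `ψ⁺ = ψ⁻` almost everywhere, and `ψ = 0`. Restricting the
times to a dense set `D` lets dyadic times suffice. -/
theorem ae_eq_zero_of_integral_cylinder_eq_zero {D : Set I} (hD : Dense D)
    {m : Measure (PathSpace d)} {ψ : PathSpace d → ℝ} (hψ : Integrable ψ m)
    (h : ∀ (J : Finset D) (f : (J → EuclideanSpace ℝ (Fin d)) → ℝ), f.HasTemperateGrowth →
      (∀ x, |f x| ≤ 1) → ∫ γ, ψ γ * f (fun j => γ (j : D)) ∂m = 0) :
    ψ =ᵐ[m] 0 := by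
  have hp : AEMeasurable (fun γ => ENNReal.ofReal (ψ γ)) m := hψ.1.aemeasurable.ennreal_ofReal
  have hn : AEMeasurable (fun γ => ENNReal.ofReal (-ψ γ)) m := hψ.1.aemeasurable.neg.ennreal_ofReal
  have hpfin : ∫⁻ γ, ENNReal.ofReal (ψ γ) ∂m ≠ ∞ := hψ.lintegral_lt_top.ne
  have hnfin : ∫⁻ γ, ENNReal.ofReal (-ψ γ) ∂m ≠ ∞ := hψ.neg.lintegral_lt_top.ne
  set μ₁ := m.withDensity fun γ => ENNReal.ofReal (ψ γ) with hμ₁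
  set μ₂ := m.withDensity fun γ => ENNReal.ofReal (-ψ γ) with hμ₂
  have : IsFiniteMeasure μ₁ := isFiniteMeasure_withDensity hpfin
  have : IsFiniteMeasure μ₂ := isFiniteMeasure_withDensity hnfin
  have hint : ∀ (μ : Measure (PathSpace d)) [IsFiniteMeasure μ] (g : PathSpace d → ℝ),
      Measurable g → (∀ γ, |g γ| ≤ 1) → Integrable g μ := fun μ _ g hg hb =>
    Integrable.of_bound hg.aestronglyMeasurable 1 (ae_of_all _ hb)
  have key : ∀ (J : Finset D) (f : (J → EuclideanSpace ℝ (Fin d)) → ℝ), f.HasTemperateGrowth →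
      (∀ x, |f x| ≤ 1) → ∫ γ, f (fun j => γ (j : D)) ∂μ₁ = ∫ γ, f (fun j => γ (j : D)) ∂μ₂ := by
    intro J f hf hb
    have hfm : Measurable fun γ : PathSpace d => f (fun j => γ (j : D)) :=
      hf.1.continuous.measurable.comp (measurable_pi_lambda _ fun j => measurable_eval ((j : D) : I))
    have hi₁ := hint μ₁ _ hfm (fun γ => hb _)
    have hi₂ := hint μ₂ _ hfm (fun γ => hb _)
    rw [hμ₁, integrable_withDensity_iff_integrable_smul₀' hp (ae_of_all _ fun _ => by simp)] at hi₁
    rw [hμ₂, integrable_withDensity_iff_integrable_smul₀' hn (ae_of_all _ fun _ => by simp)] at hi₂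
    rw [hμ₁, hμ₂, integral_withDensity_eq_integral_toReal_smul₀ hp (ae_of_all _ fun _ => by simp),
      integral_withDensity_eq_integral_toReal_smul₀ hn (ae_of_all _ fun _ => by simp),
      ← sub_eq_zero, ← integral_sub hi₁ hi₂, ← h J f hf hb]
    congr 1
    ext γ
    simp only [smul_eq_mul, ENNReal.toReal_ofReal']
    rw [← sub_mul, max_zero_sub_max_neg_zero_eq_self]
  have hμ : μ₁ = μ₂ := by
    refine measure_ext_of_finite_dimensional hD fun J => Measure.ext_of_charFunDual ?_
    ext L
    have hevJ : Measurable fun (γ : PathSpace d) (j : J) => γ (j : D) :=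
      measurable_pi_lambda _ fun j => measurable_eval ((j : D) : I)
    have hchar : ∀ (μ : Measure (PathSpace d)) [IsFiniteMeasure μ],
        charFunDual (μ.map fun (γ : PathSpace d) (j : J) => γ (j : D)) L =
        ((∫ γ, Real.cos (L fun j => γ (j : D)) ∂μ : ℝ) : ℂ) +
          ((∫ γ, Real.sin (L fun j => γ (j : D)) ∂μ : ℝ) : ℂ) * Complex.I := by
      intro μ _
      have hLm : Measurable fun γ : PathSpace d => L fun j => γ (j : D) :=
        L.continuous.measurable.comp hevJ
      have hc := (hint μ _ (Real.measurable_cos.comp hLm) fun γ => Real.abs_cos_le_one _).ofReal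
        (𝕜 := ℂ)
      have hs := (hint μ _ (Real.measurable_sin.comp hLm) fun γ => Real.abs_sin_le_one _).ofReal
        (𝕜 := ℂ)
      rw [charFunDual_apply, integral_map hevJ.aemeasurable (by fun_prop), ← integral_complex_ofReal,
        ← integral_complex_ofReal, ← integral_mul_const]
      erw [← integral_add hc (hs.mul_const Complex.I)]
      congr 1
      ext γ
      simp [Complex.exp_mul_I]
    have hcos := key J _ (Real.hasTemperateGrowth_cos.comp L.hasTemperateGrowth)
      fun x => Real.abs_cos_le_one _
    have hsin := key J _ (Real.hasTemperateGrowth_sin.comp L.hasTemperateGrowth)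
      fun x => Real.abs_sin_le_one _
    simp only [Function.comp_apply] at hcos hsin
    rw [hchar μ₁, hchar μ₂, hcos, hsin]
  have hae := (withDensity_eq_iff hp hn hpfin).1 hμ
  filter_upwards [hae] with γ hγ
  have h1 := congrArg ENNReal.toReal hγ
  simp only [ENNReal.toReal_ofReal'] at h1
  have h2 := max_zero_sub_max_neg_zero_eq_self (ψ γ)
  simp only [Pi.zero_apply]
  linarith

end Uniqueness

/-! ### Bounded sequences in Hilbert spaces -/

section Hilbert

/-- A bounded sequence in a Hilbert space has a point which lies in every closed convex set that
eventually contains the sequence. -/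
theorem exists_mem_of_eventually_mem_convex {H : Type*} [NormedAddCommGroup H]
    [InnerProductSpace ℝ H] [CompleteSpace H] (x : ℕ → H) {C : ℝ} (hC : ∀ n, ‖x n‖ ≤ C) :
    ∃ p : H, ∀ S : Set H, Convex ℝ S → IsClosed S → (∀ᶠ n in atTop, x n ∈ S) → p ∈ S := by
  -- The elements of least norm in these decreasing hulls have increasing bounded norms. The
  -- variational inequality then makes them a Cauchy sequence, and their limit lies in every closed
  -- convex set containing a tail.
  set T : ℕ → Set H := fun n => closedConvexHull ℝ (x '' Ici n)
  have hTc : ∀ n, Convex ℝ (T n) := fun n => convex_closedConvexHull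
  have hTcl : ∀ n, IsClosed (T n) := fun n => isClosed_closedConvexHull
  have hTx : ∀ n, x n ∈ T n := fun n => subset_closedConvexHull (mem_image_of_mem x self_mem_Ici)
  have hTanti : ∀ n k, n ≤ k → T k ⊆ T n := fun n k hnk =>
    (closedConvexHull ℝ).monotone (image_mono (Ici_subset_Ici.2 hnk))
  have hmin : ∀ n, ∃ p ∈ T n, ∀ w ∈ T n, 0 ≤ inner ℝ p (w - p) := by
    intro n
    obtain ⟨p, hp, h⟩ := exists_norm_eq_iInf_of_complete_convex ⟨x n, hTx n⟩
      (hTcl n).isComplete (hTc n) 0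
    refine ⟨p, hp, fun w hw => ?_⟩
    have := (norm_eq_iInf_iff_real_inner_le_zero (hTc n) hp).1 h w hw
    rw [zero_sub, inner_neg_left] at this
    linarith
  choose p hpT hp using hmin
  have hdist : ∀ n k, n ≤ k → ‖p k - p n‖ ^ 2 ≤ ‖p k‖ ^ 2 - ‖p n‖ ^ 2 := by
    intro n k hnk
    have h1 := hp n (p k) (hTanti n k hnk (hpT k))
    have h2 := norm_add_sq_real (p n) (p k - p n)
    rw [add_sub_cancel] at h2
    linarith
  have hbound : ∀ n, ‖p n‖ ≤ C := fun n => by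
    have : T n ⊆ Metric.closedBall 0 C := by
      refine closedConvexHull_min ?_ (convex_closedBall 0 C) Metric.isClosed_closedBall
      rintro _ ⟨k, -, rfl⟩
      simpa using hC k
    simpa using this (hpT n)
  have hmono : Monotone fun n => ‖p n‖ ^ 2 := fun n k hnk => by
    have := hdist n k hnk
    have := sq_nonneg ‖p k - p n‖
    simp only
    linarith
  have hbdd : BddAbove (range fun n => ‖p n‖ ^ 2) :=
    ⟨C ^ 2, by rintro _ ⟨n, rfl⟩; exact pow_le_pow_left₀ (norm_nonneg _) (hbound n) 2⟩
  have hcauchy := (tendsto_atTop_ciSup hmono hbdd).cauchySeq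
  have hpc : CauchySeq p := by
    rw [Metric.cauchySeq_iff'] at hcauchy ⊢
    intro ε hε
    obtain ⟨N, hN⟩ := hcauchy (ε ^ 2) (by positivity)
    refine ⟨N, fun n hn => ?_⟩
    have h1 := hN n hn
    rw [Real.dist_eq] at h1
    have h2 := (hdist N n hn).trans_lt ((le_abs_self _).trans_lt h1)
    rw [dist_eq_norm]
    exact lt_of_pow_lt_pow_left₀ 2 hε.le h2
  obtain ⟨q, hq⟩ := cauchySeq_tendsto_of_complete hpc
  refine ⟨q, fun S hSc hScl hS => ?_⟩
  obtain ⟨N, hN⟩ := eventually_atTop.1 hS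
  have hTS : T N ⊆ S := by
    refine closedConvexHull_min ?_ hSc hScl
    rintro _ ⟨k, hk, rfl⟩
    exact hN k hk
  exact hScl.mem_of_tendsto hq
    (eventually_atTop.2 ⟨N, fun n hn => hTS (hTanti N n hn (hpT n))⟩)

/-- Closedness of a subspace `Γ` of a product of Hilbert spaces under convergence of the first
component and bounds on the second one. -/
theorem exists_mem_of_tendsto_of_norm_le {L K : Type*} [NormedAddCommGroup L]
    [InnerProductSpace ℝ L] [CompleteSpace L] [NormedAddCommGroup K] [InnerProductSpace ℝ K]
    [CompleteSpace K] {Γ : Submodule ℝ (L × K)} (hΓ : IsClosed (Γ : Set (L × K)))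
    {x : ℕ → L} {y : ℕ → K} (hxy : ∀ n, (x n, y n) ∈ Γ) {w : L} (hx : Tendsto x atTop (𝓝 w))
    {c : ℕ → ℝ} {c₀ : ℝ} (hc : Tendsto c atTop (𝓝 c₀)) (hy : ∀ n, ‖y n‖ ≤ c n) :
    ∃ z, (w, z) ∈ Γ ∧ ‖z‖ ≤ c₀ := by
  -- The product carries the maximum norm, so the Hilbert space argument runs on its `ℓ²` version,
  -- which has the same closed convex sets.
  set e := WithLp.prodContinuousLinearEquiv 2 ℝ L K
  obtain ⟨C₁, hC₁⟩ := hx.norm.bddAbove_range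
  obtain ⟨C₂, hC₂⟩ := hc.bddAbove_range
  have hb : ∀ n, ‖e.symm (x n, y n)‖ ≤ ‖(e.symm : (L × K) →L[ℝ] WithLp 2 (L × K))‖ * max C₁ C₂ := by
    intro n
    refine ((e.symm : (L × K) →L[ℝ] WithLp 2 (L × K)).le_opNorm _).trans ?_
    gcongr
    rw [Prod.norm_mk]
    exact max_le_max (hC₁ ⟨n, rfl⟩) ((hy n).trans (hC₂ ⟨n, rfl⟩))
  obtain ⟨p, hp⟩ := exists_mem_of_eventually_mem_convex (fun n => e.symm (x n, y n)) hb
  have hp' : ∀ S : Set (L × K), Convex ℝ S → IsClosed S → (∀ᶠ n in atTop, (x n, y n) ∈ S) →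
      e p ∈ S := by
    intro S h1 h2 h3
    refine hp (e ⁻¹' S) (h1.linear_preimage e.toLinearEquiv.toLinearMap)
      (h2.preimage e.continuous) ?_
    filter_upwards [h3] with n hn
    simpa using hn
  have h1 : ∀ ε > 0, dist (e p).1 w ≤ ε ∧ ‖(e p).2‖ ≤ c₀ + ε := by
    intro ε hε
    -- A product of balls is closed and convex, so it controls the first component by strong
    -- convergence and the second by the norm bound.
    have := hp' (Metric.closedBall w ε ×ˢ Metric.closedBall 0 (c₀ + ε))
      ((convex_closedBall _ _).prod (convex_closedBall _ _))
      (Metric.isClosed_closedBall.prod Metric.isClosed_closedBall) (by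
        filter_upwards [hx.eventually (Metric.closedBall_mem_nhds w hε),
          hc.eventually (ge_mem_nhds (lt_add_of_pos_right c₀ hε))] with n hn hn'
        exact ⟨hn, by simpa using (hy n).trans hn'⟩)
    simpa using this
  have hw : (e p).1 = w := by
    refine dist_le_zero.1 (le_of_forall_pos_le_add fun ε hε => ?_)
    simpa using (h1 ε hε).1
  refine ⟨(e p).2, ?_, le_of_forall_pos_le_add fun ε hε => (h1 ε hε).2⟩
  rw [← hw]
  exact hp' Γ Γ.convex hΓ (Eventually.of_forall hxy)

end Hilbert

/-! ### Closable operators -/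

section Closable

variable {V L K : Type*} [AddCommGroup V] [Module ℝ V] [NormedAddCommGroup L] [NormedSpace ℝ L]
  [NormedAddCommGroup K] [NormedSpace ℝ K]

/-- The closure of the set of all pairs `(T v, A v)`. -/
def closureGraph (T : V →ₗ[ℝ] L) (A : V →ₗ[ℝ] K) : Submodule ℝ (L × K) :=
  (LinearMap.range (T.prod A)).topologicalClosure

/-- The operator `T v ↦ A v` is (well-defined and) closable. -/
def IsClosableOp (T : V →ₗ[ℝ] L) (A : V →ₗ[ℝ] K) : Prop :=
  ∀ (v : ℕ → V) (y : K), Tendsto (fun n => T (v n)) atTop (𝓝 0) →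
    Tendsto (fun n => A (v n)) atTop (𝓝 y) → y = 0

variable {T : V →ₗ[ℝ] L} {A : V →ₗ[ℝ] K}

theorem isClosed_closureGraph : IsClosed (closureGraph T A : Set (L × K)) :=
  Submodule.isClosed_topologicalClosure _

theorem mk_mem_closureGraph (v : V) : (T v, A v) ∈ closureGraph T A :=
  Submodule.le_topologicalClosure _ ⟨v, rfl⟩

theorem mem_closureGraph_iff {x : L} {y : K} : (x, y) ∈ closureGraph T A ↔ ∃ v : ℕ → V,
    Tendsto (fun n => T (v n)) atTop (𝓝 x) ∧ Tendsto (fun n => A (v n)) atTop (𝓝 y) := by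
  rw [closureGraph, ← SetLike.mem_coe, Submodule.topologicalClosure_coe, mem_closure_iff_seq_limit]
  constructor
  · rintro ⟨x, hx, hlim⟩
    choose F hF using hx
    rw [Prod.tendsto_iff] at hlim
    simp only [← hF] at hlim
    exact ⟨F, hlim⟩
  · rintro ⟨F, h1, h2⟩
    exact ⟨fun n => (T.prod A) (F n), fun n => ⟨F n, rfl⟩, h1.prodMk_nhds h2⟩

/-- Closability says that the closed graph contains no `(0, y)` with `y ≠ 0`, so this linear
relation is the graph of an operator. -/
theorem IsClosableOp.fst_injective (h : IsClosableOp T A) :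
    Function.Injective (LinearMap.fst ℝ L K ∘ₗ (closureGraph T A).subtype) := by
  rw [injective_iff_map_eq_zero]
  rintro ⟨⟨x, y⟩, hp⟩ h0
  obtain ⟨F, h1, h2⟩ := mem_closureGraph_iff.1 hp
  simp only [LinearMap.comp_apply, Submodule.subtype_apply, LinearMap.fst_apply] at h0
  subst h0
  obtain rfl := h F y h1 h2
  rfl

variable (T A) in
/-- The domain of the closure. -/
def closureDomain : Submodule ℝ L :=
  LinearMap.range (LinearMap.fst ℝ L K ∘ₗ (closureGraph T A).subtype)

/-- The closure of the operator `T v ↦ A v`. -/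
def IsClosableOp.closedOp (h : IsClosableOp T A) : closureDomain T A →ₗ[ℝ] K :=
  LinearMap.snd ℝ L K ∘ₗ (closureGraph T A).subtype ∘ₗ
    (LinearEquiv.ofInjective _ h.fst_injective).symm.toLinearMap

theorem IsClosableOp.mk_closedOp_mem (h : IsClosableOp T A) (u : closureDomain T A) :
    ((u : L), h.closedOp u) ∈ closureGraph T A := by
  set q := (LinearEquiv.ofInjective _ h.fst_injective).symm u
  have h1 : (u : L) = (q : L × K).1 :=
    (congrArg Subtype.val ((LinearEquiv.ofInjective _ h.fst_injective).apply_symm_apply u)).symm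
  have h2 : ((u : L), h.closedOp u) = (q : L × K) := Prod.ext h1 rfl
  rw [h2]
  exact q.2

theorem mem_closureDomain {x : L} {y : K} (h : (x, y) ∈ closureGraph T A) :
    x ∈ closureDomain T A :=
  ⟨⟨(x, y), h⟩, rfl⟩

theorem IsClosableOp.closedOp_eq (h : IsClosableOp T A) {u : closureDomain T A} {y : K}
    (hy : ((u : L), y) ∈ closureGraph T A) : h.closedOp u = y := by
  have := @IsClosableOp.fst_injective _ _ _ _ _ _ _ _ _ _ _ h
    (⟨_, h.mk_closedOp_mem u⟩ : closureGraph T A) (⟨_, hy⟩ : closureGraph T A) rfl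
  exact congrArg (fun p : closureGraph T A => (p : L × K).2) this

theorem IsClosableOp.exists_tendsto [CompleteSpace L] [CompleteSpace K] (h : IsClosableOp T A)
    (u : ℕ → closureDomain T A) (hu : CauchySeq (fun n => (u n : L)))
    (hA : CauchySeq (fun n => h.closedOp (u n))) :
    ∃ v : closureDomain T A, Tendsto (fun n => (u n : L)) atTop (𝓝 (v : L)) ∧
      Tendsto (fun n => h.closedOp (u n)) atTop (𝓝 (h.closedOp v)) := by
  obtain ⟨x, hx⟩ := cauchySeq_tendsto_of_complete hu
  obtain ⟨y, hy⟩ := cauchySeq_tendsto_of_complete hA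
  have hmem : (x, y) ∈ closureGraph T A :=
    isClosed_closureGraph.mem_of_tendsto (hx.prodMk_nhds hy)
      (Eventually.of_forall fun n => h.mk_closedOp_mem (u n))
  refine ⟨⟨x, mem_closureDomain hmem⟩, hx, ?_⟩
  rwa [h.closedOp_eq (u := ⟨x, mem_closureDomain hmem⟩) hmem]

end Closable

theorem cauchySeq_of_tendsto_dist_sq {K : Type*} [PseudoMetricSpace K] {y : ℕ → K}
    (h : Tendsto (fun p : ℕ × ℕ => dist (y p.1) (y p.2) ^ 2) atTop (𝓝 0)) : CauchySeq y := by
  rw [cauchySeq_iff_tendsto_dist_atTop_0]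
  have := h.sqrt
  simpa only [Real.sqrt_sq dist_nonneg, Real.sqrt_zero] using this

/-! ### Closures of forms given by closable gradients -/

section Closure

/-- A form `E(F, G) = ⟪grad F, grad G⟫` on a linear space `D` of square integrable functions,
with a closable gradient `grad`. -/
structure ClosableGradient {X : Type*} [MeasurableSpace X] (m : Measure X) (D : Set (X → ℝ))
    (E : (X → ℝ) → (X → ℝ) → ℝ) (K : Type*) [NormedAddCommGroup K] [InnerProductSpace ℝ K] where
  space : Submodule ℝ (X → ℝ)
  mem_space : ∀ F, F ∈ space ↔ F ∈ D
  memLp : ∀ F : space, MemLp (F : X → ℝ) 2 m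
  grad : space →ₗ[ℝ] K
  form_eq : ∀ F G : space, E F G = inner ℝ (grad F) (grad G)
  closable : ∀ (F : ℕ → space) (y : K),
    Tendsto (fun n => eLpNorm (F n : X → ℝ) 2 m) atTop (𝓝 0) →
    Tendsto (fun n => grad (F n)) atTop (𝓝 y) → y = 0

namespace ClosableGradient

variable {X : Type*} [MeasurableSpace X] {m : Measure X} {D : Set (X → ℝ)}
  {E : (X → ℝ) → (X → ℝ) → ℝ} {K : Type*} [NormedAddCommGroup K] [InnerProductSpace ℝ K]
  (S : ClosableGradient m D E K)

/-- The class in `L²` of a function in the domain. -/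
def toLp : S.space →ₗ[ℝ] Lp ℝ 2 m where
  toFun F := (S.memLp F).toLp
  map_add' _ _ := rfl
  map_smul' _ _ := rfl

theorem tendsto_toLp_iff (F : ℕ → S.space) (u : Lp ℝ 2 m) :
    Tendsto (fun n => S.toLp (F n)) atTop (𝓝 u) ↔
      Tendsto (fun n => eLpNorm ((F n : X → ℝ) - (u : X → ℝ)) 2 m) atTop (𝓝 0) := by
  have h := Lp.tendsto_Lp_iff_tendsto_eLpNorm'' (fun n => (F n : X → ℝ)) (fun n => S.memLp (F n))
    (u : X → ℝ) (Lp.memLp u) (fi := atTop)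
  rw [Lp.toLp_coeFn u (Lp.memLp u)] at h
  exact h

theorem isClosableOp : IsClosableOp S.toLp S.grad := fun F y h1 h2 => by
  refine S.closable F y ?_ h2
  have := (S.tendsto_toLp_iff F 0).1 h1
  refine this.congr fun n => eLpNorm_congr_ae ?_
  filter_upwards [Lp.coeFn_zero ℝ 2 m] with x hx
  rw [Pi.sub_apply, hx, Pi.zero_apply, sub_zero]

/-- The closure of the form. -/
def closedForm : L2Form m where
  domain := closureDomain S.toLp S.grad
  form := (innerₗ K).compl₁₂ S.isClosableOp.closedOp S.isClosableOp.closedOp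

theorem closedForm_apply (u v : closureDomain S.toLp S.grad) :
    S.closedForm.form u v =
      inner ℝ (S.isClosableOp.closedOp u) (S.isClosableOp.closedOp v) := rfl

theorem form_sub_eq (F : ℕ → S.space) (p : ℕ × ℕ) :
    E ((F p.1 : X → ℝ) - (F p.2 : X → ℝ)) ((F p.1 : X → ℝ) - (F p.2 : X → ℝ)) =
      dist (S.grad (F p.1)) (S.grad (F p.2)) ^ 2 := by
  have := S.form_eq (F p.1 - F p.2) (F p.1 - F p.2)
  rw [Submodule.coe_sub] at this
  rw [this, real_inner_self_eq_norm_sq, map_sub, dist_eq_norm]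

/-- Sequences in the domain of the form as sequences in the corresponding space. -/
theorem exists_lift {F : ℕ → X → ℝ} (hF : ∀ n, F n ∈ D) :
    ∃ F' : ℕ → S.space, F = fun n => (F' n : X → ℝ) :=
  ⟨fun n => ⟨F n, (S.mem_space _).2 (hF n)⟩, rfl⟩

/-- Approximations of the unit contraction converge along convergent sequences. -/
theorem tendsto_toLp_of_abs_sub_le [IsFiniteMeasure m] {F G : ℕ → S.space} {u : Lp ℝ 2 m}
    (hF : Tendsto (fun n => S.toLp (F n)) atTop (𝓝 u)) {ε : ℕ → ℝ} (hε : ∀ n, 0 < ε n)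
    (hε0 : Tendsto ε atTop (𝓝 0))
    (hG : ∀ n x, |(G n : X → ℝ) x - min (max ((F n : X → ℝ) x) 0) 1| ≤ ε n)
    (hcm : MemLp (fun x => min (max (u x) 0) 1) 2 m) :
    Tendsto (fun n => S.toLp (G n)) atTop (𝓝 hcm.toLp) := by
  set c : X → ℝ := fun x => min (max (u x) 0) 1 with hc
  refine (Lp.tendsto_Lp_iff_tendsto_eLpNorm'' (fun n => (G n : X → ℝ))
    (fun n => S.memLp (G n)) c hcm).2 ?_
  have hum : AEStronglyMeasurable (u : X → ℝ) m := (Lp.memLp _).1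
  have hbound : ∀ n, eLpNorm ((G n : X → ℝ) - c) 2 m ≤
      eLpNorm (fun _ : X => ε n) 2 m + eLpNorm ((F n : X → ℝ) - (u : X → ℝ)) 2 m := by
    intro n
    have hsm := ((S.memLp (F n)).1.sub hum).norm
    calc eLpNorm ((G n : X → ℝ) - c) 2 m
        -- The unit contraction is 1-Lipschitz, and `G n` differs from the contraction of `F n` by
        -- at most `ε n`, a constant that is small in `L²` as `m` is finite.
        ≤ eLpNorm ((fun _ : X => ε n) + fun x => ‖((F n : X → ℝ) - (u : X → ℝ)) x‖) 2 m := by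
          refine eLpNorm_mono_real fun x => ?_
          have h3 := hG n x
          have h4 : |min (max ((F n : X → ℝ) x) 0) 1 - min (max (u x) 0) 1| ≤
              |(F n : X → ℝ) x - u x| := by
            have h5 := abs_min_sub_min_le_max (max ((F n : X → ℝ) x) 0) 1 (max (u x) 0) 1
            have h6 := abs_max_sub_max_le_max ((F n : X → ℝ) x) 0 (u x) 0
            simp only [sub_self, abs_zero, abs_nonneg, max_eq_left] at h5 h6
            exact h5.trans h6
          simp only [Pi.sub_apply, Pi.add_apply, Real.norm_eq_abs, hc]
          calc _ = |((G n : X → ℝ) x - min (max ((F n : X → ℝ) x) 0) 1) +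
                (min (max ((F n : X → ℝ) x) 0) 1 - min (max (u x) 0) 1)| := by
                rw [sub_add_sub_cancel]
            _ ≤ _ := (abs_add_le _ _).trans (add_le_add h3 h4)
      _ ≤ _ := by
          refine (eLpNorm_add_le aestronglyMeasurable_const hsm (by norm_num)).trans ?_
          rw [eLpNorm_norm]
  have hεlim : Tendsto (fun n => eLpNorm (fun _ : X => ε n) 2 m) atTop (𝓝 0) := by
    have h5 : ∀ n, eLpNorm (fun _ : X => ε n) 2 m = ENNReal.ofReal (ε n) *
        m univ ^ (1 / (2 : ℝ≥0∞).toReal) := fun n => by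
      rw [eLpNorm_const' _ (by norm_num) (by norm_num), Real.enorm_of_nonneg (hε n).le]
    simp_rw [h5]
    have h6 := ENNReal.tendsto_ofReal hε0
    rw [ENNReal.ofReal_zero] at h6
    have h7 : m univ ^ (1 / (2 : ℝ≥0∞).toReal) ≠ ∞ :=
      ENNReal.rpow_ne_top_of_nonneg (by positivity) (measure_ne_top _ _)
    simpa using ENNReal.Tendsto.mul_const h6 (Or.inr h7)
  have h8 := hεlim.add ((S.tendsto_toLp_iff F u).1 hF)
  rw [add_zero] at h8
  exact tendsto_of_tendsto_of_tendsto_of_le_of_le tendsto_const_nhds h8 (fun _ => zero_le) hbound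

variable [CompleteSpace K]

theorem isClosableForm (S : ClosableGradient m D E K) : IsClosableForm m D E := by
  intro F hF h1 h2
  obtain ⟨F, rfl⟩ := S.exists_lift hF
  simp only [S.form_sub_eq F] at h2
  obtain ⟨y, hy⟩ := cauchySeq_tendsto_of_complete (cauchySeq_of_tendsto_dist_sq (y := fun n => S.grad (F n)) h2)
  obtain rfl := S.closable F y h1 hy
  simp_rw [S.form_eq, real_inner_self_eq_norm_sq]
  simpa using hy.norm.pow 2

theorem exists_tendsto_of_approximates {F : ℕ → S.space} {u : Lp ℝ 2 m}
    (h : Approximates m D E (fun n => (F n : X → ℝ)) u) :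
    ∃ y, Tendsto (fun n => S.grad (F n)) atTop (𝓝 y) ∧ (u, y) ∈ closureGraph S.toLp S.grad := by
  have h2 := h.cauchy
  simp only [S.form_sub_eq F] at h2
  obtain ⟨y, hy⟩ := cauchySeq_tendsto_of_complete (cauchySeq_of_tendsto_dist_sq (y := fun n => S.grad (F n)) h2)
  have h3 : Tendsto (fun n => S.toLp (F n)) atTop (𝓝 u) := (S.tendsto_toLp_iff F u).2 h.tendsto
  have h4 : (u, y) ∈ closureGraph S.toLp S.grad := mem_closureGraph_iff.2 ⟨F, h3, hy⟩
  exact ⟨y, hy, h4⟩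

theorem mem_domain_iff (u : Lp ℝ 2 m) :
    u ∈ closureDomain S.toLp S.grad ↔ ∃ F, Approximates m D E F u := by
  constructor
  · intro hu
    obtain ⟨F, h1, h2⟩ := mem_closureGraph_iff.1 (S.isClosableOp.mk_closedOp_mem ⟨u, hu⟩)
    refine ⟨fun n => (F n : X → ℝ), fun n => (S.mem_space _).1 (F n).2,
      (S.tendsto_toLp_iff F u).1 h1, ?_⟩
    simp only [S.form_sub_eq F]
    simpa using (cauchySeq_iff_tendsto_dist_atTop_0.1 h2.cauchySeq).pow 2
  · rintro ⟨F, hF⟩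
    obtain ⟨F, rfl⟩ := S.exists_lift hF.mem
    obtain ⟨y, -, hy⟩ := S.exists_tendsto_of_approximates hF
    exact mem_closureDomain hy

theorem tendsto_form (u v : closureDomain S.toLp S.grad) (F G : ℕ → X → ℝ)
    (hF : Approximates m D E F (u : Lp ℝ 2 m)) (hG : Approximates m D E G (v : Lp ℝ 2 m)) :
    Tendsto (fun n => E (F n) (G n)) atTop
      (𝓝 (inner ℝ (S.isClosableOp.closedOp u) (S.isClosableOp.closedOp v))) := by
  obtain ⟨F, rfl⟩ := S.exists_lift hF.mem
  obtain ⟨G, rfl⟩ := S.exists_lift hG.mem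
  obtain ⟨y, hy, hy'⟩ := S.exists_tendsto_of_approximates hF
  obtain ⟨z, hz, hz'⟩ := S.exists_tendsto_of_approximates hG
  rw [S.isClosableOp.closedOp_eq hy', S.isClosableOp.closedOp_eq hz']
  simp_rw [S.form_eq]
  exact hy.inner hz

theorem isClosureOf : S.closedForm.IsClosureOf D E where
  mem_domain_iff := S.mem_domain_iff
  tendsto_form := S.tendsto_form

theorem closedForm_closed (u : ℕ → closureDomain S.toLp S.grad)
    (hu : CauchySeq (fun n => (u n : Lp ℝ 2 m)))
    (h : Tendsto (fun p : ℕ × ℕ => S.closedForm.form (u p.1 - u p.2) (u p.1 - u p.2))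
      atTop (𝓝 0)) :
    ∃ v : closureDomain S.toLp S.grad,
      Tendsto (fun n => (u n : Lp ℝ 2 m)) atTop (𝓝 (v : Lp ℝ 2 m)) ∧
      Tendsto (fun n => S.closedForm.form (u n - v) (u n - v)) atTop (𝓝 0) := by
  have hform : ∀ u v : closureDomain S.toLp S.grad, S.closedForm.form (u - v) (u - v) =
      dist (S.isClosableOp.closedOp u) (S.isClosableOp.closedOp v) ^ 2 := fun u v => by
    rw [S.closedForm_apply, real_inner_self_eq_norm_sq, map_sub, dist_eq_norm]
  simp only [hform] at h ⊢
  obtain ⟨v, hv, hv'⟩ := S.isClosableOp.exists_tendsto u hu (cauchySeq_of_tendsto_dist_sq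
    (y := fun n => S.isClosableOp.closedOp (u n)) h)
  exact ⟨v, hv, by simpa using (tendsto_iff_dist_tendsto_zero.1 hv').pow 2⟩

/-- The closure is Markovian if there are smooth approximations of the unit contraction which
operate on the form. -/
theorem closedForm_unit_contraction [IsFiniteMeasure m]
    (hE : ∀ F ∈ D, ∀ ε > 0, ∃ G ∈ D, (∀ x, |G x - min (max (F x) 0) 1| ≤ ε) ∧ E G G ≤ E F F)
    (u : closureDomain S.toLp S.grad) : ∃ v : closureDomain S.toLp S.grad,
    ((v : Lp ℝ 2 m) : X → ℝ) =ᵐ[m] (fun x => min (max ((u : Lp ℝ 2 m) x) 0) 1) ∧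
      S.closedForm.form v v ≤ S.closedForm.form u u := by
  obtain ⟨F, h1, h2⟩ := mem_closureGraph_iff.1 (S.isClosableOp.mk_closedOp_mem u)
  let ε : ℕ → ℝ := fun n => 1 / ((n : ℝ) + 1)
  have hε : ∀ n, 0 < ε n := fun n => Nat.one_div_pos_of_nat
  choose G hGD hG hGE using fun n => hE _ ((S.mem_space _).1 (F n).2) (ε n) (hε n)
  obtain ⟨G, rfl⟩ := S.exists_lift hGD
  have hum : AEStronglyMeasurable ((u : Lp ℝ 2 m) : X → ℝ) m := (Lp.memLp _).1
  have hcm : MemLp (fun x => min (max ((u : Lp ℝ 2 m) x) 0) 1) 2 m := by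
    refine MemLp.of_bound ?_ 1 (ae_of_all _ fun x => ?_)
    · exact (hum.sup aestronglyMeasurable_const).inf aestronglyMeasurable_const
    · rw [Real.norm_eq_abs, abs_le]
      exact ⟨by linarith [le_min (le_max_right ((u : Lp ℝ 2 m) x) 0) zero_le_one], min_le_right _ _⟩
  have hlim := S.tendsto_toLp_of_abs_sub_le h1 hε tendsto_one_div_add_atTop_nhds_zero_nat hG hcm
  -- The functions `G n` converge in `L²`, but their gradients are only known to be bounded by those
  -- of `F n`, whose norms converge to the norm of the gradient of `u`.
  obtain ⟨z, hz, hz'⟩ := exists_mem_of_tendsto_of_norm_le isClosed_closureGraph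
    (fun n => mk_mem_closureGraph (T := S.toLp) (A := S.grad) (G n)) hlim h2.norm fun n => by
      have h3 := hGE n
      rw [S.form_eq, S.form_eq, real_inner_self_eq_norm_sq, real_inner_self_eq_norm_sq] at h3
      exact le_of_sq_le_sq h3 (norm_nonneg _)
  refine ⟨⟨hcm.toLp, mem_closureDomain hz⟩, hcm.coeFn_toLp, ?_⟩
  rw [S.closedForm_apply, S.closedForm_apply, real_inner_self_eq_norm_sq,
    real_inner_self_eq_norm_sq, S.isClosableOp.closedOp_eq (u := ⟨_, mem_closureDomain hz⟩) hz]
  exact pow_le_pow_left₀ (norm_nonneg _) hz' 2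

theorem closedForm_isDirichletForm [IsFiniteMeasure m]
    (hdense : Dense (range S.toLp))
    (hE : ∀ F ∈ D, ∀ ε > 0, ∃ G ∈ D, (∀ x, |G x - min (max (F x) 0) 1| ≤ ε) ∧ E G G ≤ E F F) :
    S.closedForm.IsDirichletForm where
  dense := hdense.mono <| by
    rintro _ ⟨F, rfl⟩
    exact mem_closureDomain (mk_mem_closureGraph F)
  symm u v := real_inner_comm _ _
  nonneg u := real_inner_self_nonneg
  closed := S.closedForm_closed
  unit_contraction := S.closedForm_unit_contraction hE

end ClosableGradient

end Closure

/-! ### Values of the Schauder functions -/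

section SchauderBounds

/-- The dyadic times. -/
def dyadicTimes : Set I := {s | ∃ M k : ℕ, (s : ℝ) = k / 2 ^ M}

theorem dense_dyadicTimes : Dense dyadicTimes := by
  rw [Metric.dense_iff]
  intro x r hr
  obtain ⟨M, hM⟩ := exists_pow_lt_of_lt_one hr (by norm_num : (1 / 2 : ℝ) < 1)
  have hpos : (0 : ℝ) < 2 ^ M := by positivity
  have h0 : 0 ≤ (x : ℝ) * 2 ^ M := mul_nonneg x.2.1 hpos.le
  have h1 := Nat.floor_le h0
  have h2 := Nat.lt_floor_add_one ((x : ℝ) * 2 ^ M)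
  have h3 : (⌊(x : ℝ) * 2 ^ M⌋₊ : ℝ) / 2 ^ M ≤ x := by rwa [div_le_iff₀ hpos]
  have h4 : (x : ℝ) - ⌊(x : ℝ) * 2 ^ M⌋₊ / 2 ^ M < (1 / 2) ^ M := by
    have h5 : (x : ℝ) < (⌊(x : ℝ) * 2 ^ M⌋₊ + 1) / 2 ^ M := by rwa [lt_div_iff₀ hpos]
    rw [one_div, inv_pow, ← one_div]
    rw [add_div] at h5
    linarith
  refine ⟨⟨(⌊(x : ℝ) * 2 ^ M⌋₊ : ℝ) / 2 ^ M, by positivity, h3.trans x.2.2⟩, ?_, M, _, rfl⟩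
  rw [Metric.mem_ball, dist_comm, Subtype.dist_eq, Real.dist_eq, abs_of_nonneg (by simpa using h3)]
  exact h4.trans hM

theorem integral_haar_eq_zero_of_le {n : ℕ} (hn : n ≠ 0) {s : ℝ} (hs : 0 ≤ s)
    (h : s ≤ haarKnot n 0 ∨ haarKnot n 2 ≤ s) : ∫ u in (0 : ℝ)..s, haar n u = 0 := by
  have h01 : haarKnot n 0 ≤ haarKnot n 1 := haarKnot_mono n (by norm_num)
  have h12 : haarKnot n 1 ≤ haarKnot n 2 := haarKnot_mono n (by norm_num)
  rw [integral_haar hn hs]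
  rcases h with h | h
  · rw [min_eq_left h, min_eq_left (h.trans h01), min_eq_left (h.trans (h01.trans h12))]
    ring
  · rw [min_eq_right h, min_eq_right (h12.trans h), min_eq_right ((h01.trans h12).trans h)]
    simp only [haarKnot]
    push_cast
    ring

/-- The Schauder functions of a high level vanish at a given dyadic time. -/
theorem integral_haar_dyadic {n M k : ℕ} (hn : n ≠ 0) (hM : M ≤ Nat.log 2 n) :
    ∫ u in (0 : ℝ)..(k / 2 ^ M), haar n u = 0 := by
  obtain ⟨j, hj⟩ := Nat.exists_eq_add_of_le hM
  have hle : 2 ^ Nat.log 2 n ≤ n := Nat.pow_log_le_self 2 hn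
  obtain ⟨r, hr⟩ := Nat.exists_eq_add_of_le hle
  have hr' : (n : ℝ) - 2 ^ Nat.log 2 n = r := by
    rw [sub_eq_iff_eq_add']
    exact_mod_cast hr
  -- On the grid of mesh `2^(-(log n + 1))` the time is an even point, and the support runs between
  -- consecutive even points `2r` and `2r + 2`, so the time is never interior to it.
  have hk : (k : ℝ) / 2 ^ M = (2 * (k * 2 ^ j : ℕ)) / 2 ^ (Nat.log 2 n + 1) := by
    rw [hj, pow_succ, pow_add]
    push_cast
    field_simp
  refine integral_haar_eq_zero_of_le hn (by positivity) ?_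
  rw [hk]
  simp only [haarKnot, hr']
  rcases Nat.lt_or_ge r (k * 2 ^ j) with h | h
  · right
    have : ((r + 1 : ℕ) : ℝ) ≤ (k * 2 ^ j : ℕ) := by exact_mod_cast h
    push_cast at this ⊢
    gcongr
    linarith
  · left
    have : ((k * 2 ^ j : ℕ) : ℝ) ≤ r := by exact_mod_cast h
    push_cast at this ⊢
    gcongr
    linarith

/-- At each level, only one Schauder function does not vanish at a given time. -/
theorem eq_of_integral_haar_ne_zero {n : ℕ} (hn : n ≠ 0) {s : ℝ} (hs : 0 ≤ s)
    (h : ∫ u in (0 : ℝ)..s, haar n u ≠ 0) :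
    n = 2 ^ Nat.log 2 n + ⌊s * 2 ^ Nat.log 2 n⌋₊ := by
  have hle : 2 ^ Nat.log 2 n ≤ n := Nat.pow_log_le_self 2 hn
  obtain ⟨r, hr⟩ := Nat.exists_eq_add_of_le hle
  have hr' : (n : ℝ) - 2 ^ Nat.log 2 n = r := by
    rw [sub_eq_iff_eq_add']
    exact_mod_cast hr
  have hpos : (0 : ℝ) < 2 ^ Nat.log 2 n := by positivity
  have hfl : ⌊s * 2 ^ Nat.log 2 n⌋₊ = r := by
    rw [Nat.floor_eq_iff (by positivity)]
    have h1 : ¬ (s ≤ haarKnot n 0 ∨ haarKnot n 2 ≤ s) := fun h' =>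
      h (integral_haar_eq_zero_of_le hn hs h')
    push Not at h1
    have h2 : haarKnot n 0 = r / 2 ^ Nat.log 2 n := by
      rw [haarKnot, hr', pow_succ]; push_cast; field_simp; ring
    have h3 : haarKnot n 2 = (r + 1) / 2 ^ Nat.log 2 n := by
      rw [haarKnot, hr', pow_succ]; push_cast; field_simp
    rw [h2, h3, div_lt_iff₀ hpos, lt_div_iff₀ hpos] at h1
    exact ⟨h1.1.le, h1.2⟩
  omega

/-- At level `m` the primitive is a tent of height `2^(m/2) 2^(-(m+1))`; the resulting factor `1/4`
is given away. -/
theorem sq_integral_haar_le {n : ℕ} (hn : n ≠ 0) {s : ℝ} (hs : 0 ≤ s) :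
    (∫ u in (0 : ℝ)..s, haar n u) ^ 2 ≤ (1 / 2) ^ Nat.log 2 n := by
  have hpos : (0 : ℝ) < 2 ^ Nat.log 2 n := by positivity
  have h01 : haarKnot n 1 - haarKnot n 0 = 1 / 2 ^ (Nat.log 2 n + 1) := by
    simp only [haarKnot]; push_cast; ring
  have h12 : haarKnot n 2 - haarKnot n 1 = 1 / 2 ^ (Nat.log 2 n + 1) := by
    simp only [haarKnot]; push_cast; ring
  rw [integral_haar hn hs, mul_pow, Real.sq_sqrt hpos.le]
  set δ : ℝ := 1 / 2 ^ (Nat.log 2 n + 1) with hδ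
  have hδ0 : 0 < δ := by positivity
  have habs : |2 * min s (haarKnot n 1) - min s (haarKnot n 0) - min s (haarKnot n 2)| ≤ δ := by
    rw [abs_le]
    rcases le_total s (haarKnot n 0) with h0 | h0 <;> rcases le_total s (haarKnot n 1) with h1 | h1 <;>
      rcases le_total s (haarKnot n 2) with h2 | h2 <;>
      simp only [min_eq_left, min_eq_right, h0, h1, h2] <;> constructor <;> linarith
  have h2 : (2 * min s (haarKnot n 1) - min s (haarKnot n 0) - min s (haarKnot n 2)) ^ 2 ≤ δ ^ 2 := by
    rw [← sq_abs]
    exact pow_le_pow_left₀ (abs_nonneg _) habs 2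
  calc _ ≤ 2 ^ Nat.log 2 n * δ ^ 2 := by gcongr
    _ = (1 / 2) ^ Nat.log 2 n * (1 / 4) := by
        rw [hδ, one_div_pow, one_div_pow, pow_succ (2 : ℝ) (Nat.log 2 n)]
        field_simp
        norm_num
    _ ≤ _ := by
        have : (0 : ℝ) < (1 / 2) ^ Nat.log 2 n := by positivity
        linarith

/-- With `m = log (n / d)`, `n` lies below `2^(m+1) d`, the leading term of the index with `p = m +
2` and first coordinate; the digits only increase that index. With `λ` monotone, a single
coefficient thus dominates all those of level `m`. -/
theorem index_lt_haarIndex {d : ℕ} (hd : 0 < d) (c : ℕ → Fin 2) (n : ℕ) :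
    n < haarIndex d c (Nat.log 2 (n / d) + 2) ⟨0, hd⟩ := by
  have h1 : n / d < 2 ^ (Nat.log 2 (n / d) + 1) := Nat.lt_pow_succ_log_self one_lt_two _
  have h2 : n < 2 ^ (Nat.log 2 (n / d) + 1) * d := (Nat.div_lt_iff_lt_mul hd).1 h1
  simp only [haarIndex, add_zero]
  have h3 : Nat.log 2 (n / d) + 2 - 1 = Nat.log 2 (n / d) + 1 := by omega
  rw [h3]
  omega

theorem tsum_mul_sq_integral_haar_lt_top {d : ℕ} (hd : 0 < d) {lam : ℕ → ℝ}
    (hlam_mono : Monotone lam) (c : ℕ → Fin 2)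
    (hsum : ∀ j : Fin d, Summable (fun p : ℕ => lam (haarIndex d c (p + 1) j) / 2 ^ (p + 1)))
    (hlam_pos : ∀ n, 0 < lam n) {s : ℝ} (hs : 0 ≤ s) :
    ∑' n, ENNReal.ofReal (lam n) *
      ENNReal.ofReal ((∫ u in (0 : ℝ)..s, haar (n / d) u) ^ 2) < ∞ := by
  have hd' : NeZero d := ⟨hd.ne'⟩
  set Λ : ℕ → ℝ := fun m => lam (haarIndex d c (m + 2) ⟨0, hd⟩) with hΛ
  set h : ℕ → ℝ≥0∞ := fun m => ENNReal.ofReal (Λ m * (1 / 2) ^ m) with hh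
  have hΛsum : Summable fun m => Λ m * (1 / 2) ^ m := by
    -- Level `m` is matched with `p = m + 2`; the factor `4` turns `2^(-(m+2))` into `2^(-m)`.
    have h1 := ((summable_nat_add_iff 1).2 (hsum ⟨0, hd⟩)).mul_left 4
    refine h1.congr fun m => ?_
    simp only [hΛ, one_div_pow]
    rw [show m + 1 + 1 = m + 2 from rfl, pow_add]
    field_simp
    ring
  have hhsum : ∑' m, h m ≠ ∞ := hΛsum.tsum_ofReal_ne_top
  -- The majorant for scalar Haar index `N`: a separate term for the constant function, and at each
  -- level `m` the only index that can contribute at time `s`. Exchanging the sums leaves one term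
  -- per level, and each `N` serves `d` values of `n`.
  set g : ℕ → ℝ≥0∞ := fun N =>
    (if N = 0 then ENNReal.ofReal (Λ 0) * ENNReal.ofReal ((∫ u in (0 : ℝ)..s, haar 0 u) ^ 2) else 0) +
      ∑' m, if N = 2 ^ m + ⌊s * 2 ^ m⌋₊ then h m else 0 with hg
  have hgsum : ∑' N, g N < ∞ := by
    rw [hg, ENNReal.tsum_add, tsum_ite_eq, ENNReal.tsum_comm]
    simp_rw [tsum_ite_eq]
    exact ENNReal.add_lt_top.2 ⟨ENNReal.mul_lt_top ENNReal.ofReal_lt_top ENNReal.ofReal_lt_top,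
      hhsum.lt_top⟩
  have hbound : ∀ n, ENNReal.ofReal (lam n) *
      ENNReal.ofReal ((∫ u in (0 : ℝ)..s, haar (n / d) u) ^ 2) ≤ g (n / d) := by
    intro n
    have hlam : lam n ≤ Λ (Nat.log 2 (n / d)) := hlam_mono (index_lt_haarIndex hd c n).le
    rcases eq_or_ne (n / d) 0 with h0 | h0
    · rw [h0] at hlam ⊢
      simp only [hg, if_true]
      refine le_trans ?_ le_self_add
      gcongr
      simpa using hlam
    · rcases eq_or_ne (∫ u in (0 : ℝ)..s, haar (n / d) u) 0 with hz | hz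
      · simp [hz]
      · simp only [hg, h0, if_false, zero_add]
        refine le_trans ?_ (ENNReal.le_tsum (Nat.log 2 (n / d)))
        rw [if_pos (eq_of_integral_haar_ne_zero h0 hs hz), hh,
          ← ENNReal.ofReal_mul (hlam_pos n).le]
        refine ENNReal.ofReal_le_ofReal ?_
        exact mul_le_mul hlam (sq_integral_haar_le h0 hs) (sq_nonneg _) (hlam_pos _).le
  calc _ ≤ ∑' n, g (n / d) := ENNReal.tsum_le_tsum hbound
    _ = ∑' p : ℕ × Fin d, g p.1 := by
        rw [← (Nat.divModEquiv d).tsum_eq]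
        rfl
    _ = d * ∑' N, g N := by
        rw [ENNReal.tsum_prod (f := fun N (_ : Fin d) => g N), ← ENNReal.tsum_mul_left]
        congr 1
        ext N
        simp
    _ < ∞ := ENNReal.mul_lt_top (ENNReal.natCast_lt_top d) hgsum

end SchauderBounds

/-! ### Derivatives along the Schauder functions -/

section SchauderDeriv

variable {d : ℕ}

/-- The derivative `⟨S_n, DF⟩` of a cylindrical function along a Schauder function. -/
def schauderDeriv (hd : 0 < d) (n : ℕ) : cylinderSubmodule d →ₗ[ℝ] cylinderSubmodule d where
  toFun F := ⟨fun γ => cmInner (schauder d n) (cylinderGradient (F : PathSpace d → ℝ) γ), by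
    obtain ⟨F, hF⟩ := F
    obtain ⟨k, s, f, hf, rfl⟩ := exists_comp_eval hF
    simp only [cmInner_schauder_cylinderGradient hd s hf]
    exact comp_eval_mem_cylinderFunctions s (hf.fderiv_apply fun i => schauder d n (s i))⟩
  map_add' F G := by
    obtain ⟨F, hF⟩ := F
    obtain ⟨G, hG⟩ := G
    obtain ⟨ι, _, s, f, g, hf, hg, rfl, rfl⟩ := exists_comp_eval₂ hF hG
    ext γ
    have h := cmInner_schauder_cylinderGradient hd s (hf.add hg) n γ
    rw [fderiv_add hf.differentiable.differentiableAt hg.differentiable.differentiableAt,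
      add_apply, ← cmInner_schauder_cylinderGradient hd s hf,
      ← cmInner_schauder_cylinderGradient hd s hg] at h
    exact h
  map_smul' c F := by
    obtain ⟨F, hF⟩ := F
    obtain ⟨k, s, f, hf, rfl⟩ := exists_comp_eval hF
    ext γ
    have h := cmInner_schauder_cylinderGradient hd s
      ((Function.HasTemperateGrowth.const c).mul hf) n γ
    have h2 : fderiv ℝ (fun x => c * f x) (fun i => γ (s i)) =
        c • fderiv ℝ f (fun i => γ (s i)) :=
      fderiv_const_mul hf.differentiable.differentiableAt c
    have h3 : (fun _ => c) * f = fun x => c * f x := rfl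
    rw [h3, h2, smul_apply,
      ← cmInner_schauder_cylinderGradient hd s hf] at h
    exact h

theorem schauderDeriv_mul (hd : 0 < d) (n : ℕ) (F G : cylinderSubmodule d) (γ : PathSpace d) :
    (schauderDeriv hd n ⟨F * G, mul_mem_cylinderFunctions F.2 G.2⟩ : PathSpace d → ℝ) γ =
      (schauderDeriv hd n F : PathSpace d → ℝ) γ * (G : PathSpace d → ℝ) γ +
      (F : PathSpace d → ℝ) γ * (schauderDeriv hd n G : PathSpace d → ℝ) γ := by
  obtain ⟨F, hF⟩ := F
  obtain ⟨G, hG⟩ := G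
  obtain ⟨ι, _, s, f, g, hf, hg, rfl, rfl⟩ := exists_comp_eval₂ hF hG
  have h := cmInner_schauder_cylinderGradient hd s (hf.mul hg) n γ
  rw [fderiv_mul hf.differentiable.differentiableAt hg.differentiable.differentiableAt,
    add_apply, smul_apply, smul_apply,
    ← cmInner_schauder_cylinderGradient hd s hf,
    ← cmInner_schauder_cylinderGradient hd s hg] at h
  refine h.trans ?_
  simp only [smul_eq_mul, schauderDeriv, LinearMap.coe_mk, AddHom.coe_mk]
  ring

theorem schauderDeriv_comp (hd : 0 < d) (n : ℕ) (F : cylinderSubmodule d) {η : ℝ → ℝ}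
    (hη : η.HasTemperateGrowth) (γ : PathSpace d) {c : ℝ}
    (hc : HasDerivAt η c ((F : PathSpace d → ℝ) γ)) :
    (schauderDeriv hd n ⟨η ∘ F, comp_mem_cylinderFunctions F.2 hη⟩ : PathSpace d → ℝ) γ =
      c * (schauderDeriv hd n F : PathSpace d → ℝ) γ := by
  obtain ⟨F, hF⟩ := F
  obtain ⟨k, s, f, hf, rfl⟩ := exists_comp_eval hF
  have h := cmInner_schauder_cylinderGradient hd s (hη.comp hf) n γ
  have h2 : HasFDerivAt (η ∘ f) (c • fderiv ℝ f (fun i => γ (s i))) (fun i => γ (s i)) :=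
    HasDerivAt.comp_hasFDerivAt (h₂ := η) _ hc (hf.differentiable _).hasFDerivAt
  rw [h2.fderiv, smul_apply,
    ← cmInner_schauder_cylinderGradient hd s hf] at h
  exact h

/-- The derivatives of a cylindrical function with dyadic times along all but finitely many
Schauder functions vanish. -/
theorem eventually_schauderDeriv_eq_zero (hd : 0 < d) {ι : Type*} [Fintype ι] (s : ι → I)
    (hs : ∀ i, s i ∈ dyadicTimes) {F : cylinderSubmodule d}
    {f : (ι → EuclideanSpace ℝ (Fin d)) → ℝ} (hf : f.HasTemperateGrowth)
    (hF : (F : PathSpace d → ℝ) = fun γ => f (fun i => γ (s i))) :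
    ∃ N, ∀ n, N ≤ n → schauderDeriv hd n F = 0 := by
  choose M k hk using hs
  -- The sum of the exponents is a common dyadic level for all the times; the factor `d` accounts
  -- for `n / d`.
  refine ⟨d * 2 ^ (∑ i, M i), fun n hn => ?_⟩
  obtain ⟨F, hF'⟩ := F
  obtain rfl := hF
  ext γ
  refine (cmInner_schauder_cylinderGradient hd s hf n γ).trans ?_
  have hn' : 2 ^ (∑ i, M i) ≤ n / d := (Nat.le_div_iff_mul_le hd).2 (by rwa [mul_comm] at hn)
  have hn0 : n / d ≠ 0 := (lt_of_lt_of_le (by positivity) hn').ne'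
  have h0 : (fun i => schauder d n (s i)) = 0 := by
    ext1 i
    rw [schauder_eq hd, hk, integral_haar_dyadic hn0, zero_smul, Pi.zero_apply]
    exact (Finset.single_le_sum (fun _ _ => Nat.zero_le _) (Finset.mem_univ i)).trans
      ((Nat.le_log_iff_pow_le one_lt_two hn0).2 hn')
  rw [h0, map_zero]
  rfl

/-- The square of the derivative along a Schauder function is controlled by the values of the
Schauder function. -/
theorem exists_sq_schauderDeriv_le (hd : 0 < d) (F : cylinderSubmodule d) :
    ∃ (k : ℕ) (s : Fin k → I), ∃ B ∈ cylinderFunctions d, ∀ n γ,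
      (schauderDeriv hd n F : PathSpace d → ℝ) γ ^ 2 ≤
        (∑ i, (∫ u in (0 : ℝ)..s i, haar (n / d) u) ^ 2) * B γ := by
  obtain ⟨F, hF⟩ := F
  obtain ⟨k, s, f, hf, rfl⟩ := exists_comp_eval hF
  set v : Fin k → Fin d → Fin k → EuclideanSpace ℝ (Fin d) := fun i j =>
    Pi.single i (EuclideanSpace.single j 1) with hv
  have hmem : ∀ i j, (fun γ : PathSpace d => fderiv ℝ f (fun i => γ (s i)) (v i j)) ∈
      cylinderFunctions d := fun i j =>
    comp_eval_mem_cylinderFunctions s (hf.fderiv_apply (v i j))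
  -- Summing over all coordinates `j`, and not only `n % d`, makes the bound independent of `n`.
  -- Cauchy–Schwarz in `i` then separates `n` from `γ`.
  refine ⟨k, s, ∑ i, ∑ j, (fun γ => fderiv ℝ f (fun i => γ (s i)) (v i j)) *
    (fun γ => fderiv ℝ f (fun i => γ (s i)) (v i j)),
    Submodule.sum_mem (cylinderSubmodule d) fun i _ =>
      Submodule.sum_mem (cylinderSubmodule d) fun j _ =>
        mul_mem_cylinderFunctions (hmem i j) (hmem i j), fun n γ => ?_⟩
  set L := fderiv ℝ f (fun i => γ (s i)) with hL
  set j₀ : Fin d := ⟨n % d, Nat.mod_lt n hd⟩ with hj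
  have h1 : (schauderDeriv hd n ⟨_, hF⟩ : PathSpace d → ℝ) γ =
      ∑ i, (∫ u in (0 : ℝ)..s i, haar (n / d) u) * L (v i j₀) := by
    refine (cmInner_schauder_cylinderGradient hd s hf n γ).trans ?_
    have h2 : (fun i => schauder d n (s i)) =
        ∑ i, (∫ u in (0 : ℝ)..s i, haar (n / d) u) • v i j₀ := by
      rw [← Finset.univ_sum_single (fun i => schauder d n (s i))]
      refine Finset.sum_congr rfl fun i _ => ?_
      rw [schauder_eq hd, hv, Pi.single_smul]
    rw [h2, map_sum]
    simp only [map_smul, smul_eq_mul, hL]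
  rw [h1]
  refine (Finset.sum_mul_sq_le_sq_mul_sq _ _ _).trans ?_
  refine mul_le_mul_of_nonneg_left ?_ (Finset.sum_nonneg fun i _ => sq_nonneg _)
  simp only [Finset.sum_apply, ← pow_two]
  refine Finset.sum_le_sum fun i _ => ?_
  exact Finset.single_le_sum (f := fun j => L (v i j) ^ 2) (fun j _ => sq_nonneg _)
    (Finset.mem_univ j₀)

end SchauderDeriv

/-! ### The weighted measure -/

section Weighted

variable {d : ℕ} {ν : Measure (PathSpace d)} {φ : PathSpace d → ℝ} {c : ℝ}

theorem integrable_of_integrable_div (hφm : AEMeasurable φ ν)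
    (hc : ∀ᵐ γ ∂ν, 0 < φ γ ∧ φ γ ≤ c) {F : PathSpace d → ℝ}
    (hF : Integrable (fun γ => F γ / φ γ) ν) : Integrable F ν := by
  have h := hF.mul_bdd (c := c) hφm.aestronglyMeasurable (g := φ) (by
    filter_upwards [hc] with γ hγ
    rw [Real.norm_of_nonneg hγ.1.le]
    exact hγ.2)
  refine h.congr ?_
  filter_upwards [hc] with γ hγ
  exact div_mul_cancel₀ _ hγ.1.ne'

theorem weightedMeasure_le (hc : ∀ᵐ γ ∂ν, 0 < φ γ ∧ φ γ ≤ c) :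
    weightedMeasure ν φ ≤ ENNReal.ofReal c • ν := by
  rw [weightedMeasure, ← withDensity_const]
  exact withDensity_mono (hc.mono fun _ hγ => ENNReal.ofReal_le_ofReal hγ.2)

theorem weightedMeasure_absolutelyContinuous : weightedMeasure ν φ ≪ ν :=
  withDensity_absolutelyContinuous _ _

theorem absolutelyContinuous_weightedMeasure (hφm : AEMeasurable φ ν)
    (hc : ∀ᵐ γ ∂ν, 0 < φ γ ∧ φ γ ≤ c) : ν ≪ weightedMeasure ν φ :=
  withDensity_absolutelyContinuous' hφm.ennreal_ofReal
    (hc.mono fun _ hγ => (ENNReal.ofReal_pos.2 hγ.1).ne')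

theorem isFiniteMeasure_weightedMeasure [IsFiniteMeasure ν]
    (hc : ∀ᵐ γ ∂ν, 0 < φ γ ∧ φ γ ≤ c) : IsFiniteMeasure (weightedMeasure ν φ) :=
  ⟨(weightedMeasure_le hc _).trans_lt (by
    rw [Measure.smul_apply, smul_eq_mul]
    exact ENNReal.mul_lt_top ENNReal.ofReal_lt_top (measure_lt_top ν _))⟩

theorem integrable_weightedMeasure_iff (hφm : AEMeasurable φ ν)
    (hc : ∀ᵐ γ ∂ν, 0 < φ γ ∧ φ γ ≤ c) {g : PathSpace d → ℝ} :
    Integrable g (weightedMeasure ν φ) ↔ Integrable (fun γ => φ γ * g γ) ν := by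
  rw [weightedMeasure, integrable_withDensity_iff_integrable_smul₀' hφm.ennreal_ofReal
    (ae_of_all _ fun _ => ENNReal.ofReal_lt_top)]
  refine integrable_congr ?_
  filter_upwards [hc] with γ hγ
  rw [ENNReal.toReal_ofReal hγ.1.le, smul_eq_mul]

theorem integral_weightedMeasure (hφm : AEMeasurable φ ν)
    (hc : ∀ᵐ γ ∂ν, 0 < φ γ ∧ φ γ ≤ c) (g : PathSpace d → ℝ) :
    ∫ γ, g γ ∂weightedMeasure ν φ = ∫ γ, φ γ * g γ ∂ν := by
  rw [weightedMeasure, integral_withDensity_eq_integral_toReal_smul₀ hφm.ennreal_ofReal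
    (ae_of_all _ fun _ => ENNReal.ofReal_lt_top)]
  refine integral_congr_ae ?_
  filter_upwards [hc] with γ hγ
  rw [ENNReal.toReal_ofReal hγ.1.le, smul_eq_mul]

theorem memLp_two_weightedMeasure (hφm : AEMeasurable φ ν)
    (hc : ∀ᵐ γ ∂ν, 0 < φ γ ∧ φ γ ≤ c)
    (hφ : ∀ F ∈ cylinderFunctions d, Integrable (fun γ => F γ / φ γ) ν)
    {F : PathSpace d → ℝ} (hF : F ∈ cylinderFunctions d) : MemLp F 2 (weightedMeasure ν φ) := by
  rw [memLp_two_iff_integrable_sq (measurable_of_mem_cylinderFunctions hF).aestronglyMeasurable]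
  have h := integrable_of_integrable_div hφm hc (hφ _ (mul_mem_cylinderFunctions hF hF))
  refine ((h.smul_measure ENNReal.ofReal_ne_top).mono_measure (weightedMeasure_le hc)).congr ?_
  exact ae_of_all _ fun γ => (pow_two _).symm

/-- `∫ (F/φ)² φ dν = ∫ F²/φ dν`, and `F²` is cylindrical. The integrability of `F/φ` for all
cylindrical `F` is used here in its full strength. -/
theorem memLp_two_div_weightedMeasure (hφm : AEMeasurable φ ν)
    (hc : ∀ᵐ γ ∂ν, 0 < φ γ ∧ φ γ ≤ c)
    (hφ : ∀ F ∈ cylinderFunctions d, Integrable (fun γ => F γ / φ γ) ν)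
    {F : PathSpace d → ℝ} (hF : F ∈ cylinderFunctions d) :
    MemLp (fun γ => F γ / φ γ) 2 (weightedMeasure ν φ) := by
  rw [memLp_two_iff_integrable_sq, integrable_weightedMeasure_iff hφm hc]
  · refine (hφ _ (mul_mem_cylinderFunctions hF hF)).congr ?_
    filter_upwards [hc] with γ hγ
    have := hγ.1.ne'
    simp only [Pi.mul_apply]
    field_simp
  · exact ((measurable_of_mem_cylinderFunctions hF).aemeasurable.div
      hφm).aestronglyMeasurable.mono_ac weightedMeasure_absolutelyContinuous

/-- For cylindrical `G`, the functional `u ↦ ∫ G u dν` is continuous on `L²(φν)`. -/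
theorem exists_inner_eq_integral (hφm : AEMeasurable φ ν)
    (hc : ∀ᵐ γ ∂ν, 0 < φ γ ∧ φ γ ≤ c)
    (hφ : ∀ F ∈ cylinderFunctions d, Integrable (fun γ => F γ / φ γ) ν)
    {G : PathSpace d → ℝ} (hG : G ∈ cylinderFunctions d) :
    ∃ w : Lp ℝ 2 (weightedMeasure ν φ), ∀ u : Lp ℝ 2 (weightedMeasure ν φ),
      Integrable (fun γ => G γ * u γ) ν ∧ inner ℝ w u = ∫ γ, G γ * u γ ∂ν := by
  have hw := memLp_two_div_weightedMeasure hφm hc hφ hG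
  -- The representing vector is `G/φ`: the density `φ` of the weighted measure cancels.
  refine ⟨hw.toLp, fun u => ?_⟩
  have hcongr : (fun γ => φ γ * (G γ / φ γ * u γ)) =ᵐ[ν] fun γ => G γ * u γ := by
    filter_upwards [hc] with γ hγ
    have := hγ.1.ne'
    field_simp
  constructor
  · have h1 : Integrable (fun γ => G γ / φ γ * u γ) (weightedMeasure ν φ) :=
      hw.integrable_mul (Lp.memLp u)
    exact ((integrable_weightedMeasure_iff hφm hc).1 h1).congr hcongr
  · rw [L2.inner_def, ← integral_congr_ae hcongr, ← integral_weightedMeasure hφm hc]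
    refine integral_congr_ae ?_
    filter_upwards [hw.coeFn_toLp] with γ hγ
    rw [hγ]
    simp [mul_comm]

end Weighted

/-! ### The gradient of a diffusion form -/

section Gradient

variable {d : ℕ} {m : Measure (PathSpace d)}

/-- The class in `L²(m)` of a cylindrical function. -/
def cylinderToLp (hm : ∀ F ∈ cylinderFunctions d, MemLp F 2 m) :
    cylinderSubmodule d →ₗ[ℝ] Lp ℝ 2 m where
  toFun F := (hm F F.2).toLp
  map_add' _ _ := rfl
  map_smul' _ _ := rfl

theorem coeFn_cylinderToLp (hm : ∀ F ∈ cylinderFunctions d, MemLp F 2 m)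
    (F : cylinderSubmodule d) : (cylinderToLp hm F : PathSpace d → ℝ) =ᵐ[m] F :=
  (hm F F.2).coeFn_toLp

/-- The sequence `√λ_n ⟨S_n, DF⟩`. -/
def gradSeq (hd : 0 < d) (hm : ∀ F ∈ cylinderFunctions d, MemLp F 2 m) (lam : ℕ → ℝ) :
    cylinderSubmodule d →ₗ[ℝ] ℕ → Lp ℝ 2 m :=
  LinearMap.pi fun n => √(lam n) • (cylinderToLp hm ∘ₗ schauderDeriv hd n)

theorem gradSeq_apply (hd : 0 < d) (hm : ∀ F ∈ cylinderFunctions d, MemLp F 2 m) (lam : ℕ → ℝ)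
    (F : cylinderSubmodule d) (n : ℕ) :
    gradSeq hd hm lam F n = √(lam n) • cylinderToLp hm (schauderDeriv hd n F) := rfl

variable {lam : ℕ → ℝ}

theorem inner_gradSeq (hd : 0 < d) (hm : ∀ F ∈ cylinderFunctions d, MemLp F 2 m)
    (hlam : ∀ n, 0 < lam n) (F G : cylinderSubmodule d) (n : ℕ) :
    inner ℝ (gradSeq hd hm lam F n) (gradSeq hd hm lam G n) = lam n *
      ∫ γ, cmInner (schauder d n) (cylinderGradient F γ) *
        cmInner (schauder d n) (cylinderGradient G γ) ∂m := by
  rw [gradSeq_apply, gradSeq_apply, inner_smul_left, inner_smul_right, ← mul_assoc,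
    RCLike.conj_to_real, Real.mul_self_sqrt (hlam n).le, L2.inner_def]
  congr 1
  refine integral_congr_ae ?_
  filter_upwards [coeFn_cylinderToLp hm (schauderDeriv hd n F),
    coeFn_cylinderToLp hm (schauderDeriv hd n G)] with γ h1 h2
  rw [h1, h2]
  exact mul_comm _ _

theorem ofReal_norm_sq_gradSeq (hd : 0 < d) (hm : ∀ F ∈ cylinderFunctions d, MemLp F 2 m)
    (hlam : ∀ n, 0 < lam n) (F : cylinderSubmodule d) (n : ℕ) :
    ENNReal.ofReal (‖gradSeq hd hm lam F n‖ ^ 2) = ENNReal.ofReal (lam n) *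
      ∫⁻ γ, ENNReal.ofReal (cmInner (schauder d n) (cylinderGradient F γ) ^ 2) ∂m := by
  rw [← real_inner_self_eq_norm_sq, inner_gradSeq hd hm hlam, ENNReal.ofReal_mul (hlam n).le,
    ← ofReal_integral_eq_lintegral_ofReal]
  · simp only [pow_two]
  · exact (hm _ (schauderDeriv hd n F).2).integrable_sq
  · exact ae_of_all _ fun γ => sq_nonneg _

theorem diffusionEnergy_eq_tsum (hd : 0 < d) (hm : ∀ F ∈ cylinderFunctions d, MemLp F 2 m)
    (hlam : ∀ n, 0 < lam n) (F : cylinderSubmodule d) :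
    diffusionEnergy lam m F = ∑' n, ENNReal.ofReal (‖gradSeq hd hm lam F n‖ ^ 2) :=
  tsum_congr fun n => (ofReal_norm_sq_gradSeq hd hm hlam F n).symm

/-- This needs no finiteness: for infinite energy, the real series and `toReal` both take the
default value `0`. -/
theorem diffusionForm_self (hd : 0 < d) (hm : ∀ F ∈ cylinderFunctions d, MemLp F 2 m)
    (hlam : ∀ n, 0 < lam n) (F : cylinderSubmodule d) :
    diffusionForm lam m F F = (diffusionEnergy lam m F).toReal := by
  rw [diffusionEnergy_eq_tsum hd hm hlam, ENNReal.tsum_toReal_eq fun _ => ENNReal.ofReal_ne_top]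
  refine tsum_congr fun n => ?_
  rw [ENNReal.toReal_ofReal (sq_nonneg _), ← real_inner_self_eq_norm_sq,
    inner_gradSeq hd hm hlam]

theorem diffusionEnergy_lt_top_iff (hd : 0 < d) (hm : ∀ F ∈ cylinderFunctions d, MemLp F 2 m)
    (hlam : ∀ n, 0 < lam n) (F : cylinderSubmodule d) :
    diffusionEnergy lam m F < ∞ ↔ Memℓp (gradSeq hd hm lam F) 2 := by
  rw [diffusionEnergy_eq_tsum hd hm hlam, memℓp_gen_iff (by norm_num)]
  simp only [ENNReal.toReal_ofNat, Real.rpow_ofNat]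
  refine ⟨fun h => ?_, fun h => h.tsum_ofReal_lt_top⟩
  refine (ENNReal.summable_toReal h.ne).congr fun n => ?_
  rw [ENNReal.toReal_ofReal (sq_nonneg _)]

/-- The cylindrical functions of finite energy. -/
def finiteEnergySubmodule (hd : 0 < d) (hm : ∀ F ∈ cylinderFunctions d, MemLp F 2 m)
    (lam : ℕ → ℝ) : Submodule ℝ (PathSpace d → ℝ) where
  carrier := {F | ∃ h : F ∈ cylinderSubmodule d, Memℓp (gradSeq hd hm lam ⟨F, h⟩) 2}
  add_mem' := by
    rintro F G ⟨hF, hF'⟩ ⟨hG, hG'⟩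
    refine ⟨add_mem hF hG, ?_⟩
    have := hF'.add hG'
    rwa [← map_add] at this
  zero_mem' := ⟨zero_mem _, by
    have : gradSeq hd hm lam ⟨0, zero_mem _⟩ = 0 := map_zero (gradSeq hd hm lam)
    rw [this]
    exact zero_memℓp⟩
  smul_mem' := by
    rintro c F ⟨hF, hF'⟩
    refine ⟨Submodule.smul_mem _ c hF, ?_⟩
    have := hF'.const_smul c
    rwa [← map_smul] at this

theorem mem_finiteEnergySubmodule (hd : 0 < d) (hm : ∀ F ∈ cylinderFunctions d, MemLp F 2 m)
    (hlam : ∀ n, 0 < lam n) (F : PathSpace d → ℝ) :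
    F ∈ finiteEnergySubmodule hd hm lam ↔ F ∈ initialDomain lam m :=
  ⟨fun ⟨h, h'⟩ => ⟨h, (diffusionEnergy_lt_top_iff hd hm hlam ⟨F, h⟩).2 h'⟩,
    fun ⟨h, h'⟩ => ⟨h, (diffusionEnergy_lt_top_iff hd hm hlam ⟨F, h⟩).1 h'⟩⟩

/-- The gradient `F ↦ (√λ_n ⟨S_n, DF⟩)_n` of the diffusion form. -/
def diffusionGrad (hd : 0 < d) (hm : ∀ F ∈ cylinderFunctions d, MemLp F 2 m) (lam : ℕ → ℝ) :
    finiteEnergySubmodule hd hm lam →ₗ[ℝ] lp (fun _ : ℕ => Lp ℝ 2 m) 2 where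
  toFun F := ⟨gradSeq hd hm lam ⟨F, F.2.1⟩, F.2.2⟩
  map_add' F G := lp.ext (map_add (gradSeq hd hm lam)
    (⟨(F : PathSpace d → ℝ), F.2.1⟩ : cylinderSubmodule d)
    (⟨(G : PathSpace d → ℝ), G.2.1⟩ : cylinderSubmodule d))
  map_smul' c F := lp.ext (map_smul (gradSeq hd hm lam) c
    (⟨(F : PathSpace d → ℝ), F.2.1⟩ : cylinderSubmodule d))

theorem diffusionForm_eq_inner (hd : 0 < d) (hm : ∀ F ∈ cylinderFunctions d, MemLp F 2 m)
    (hlam : ∀ n, 0 < lam n) (F G : finiteEnergySubmodule hd hm lam) :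
    diffusionForm lam m F G =
      inner ℝ (diffusionGrad hd hm lam F) (diffusionGrad hd hm lam G) := by
  rw [lp.inner_eq_tsum]
  exact tsum_congr fun n =>
    (inner_gradSeq hd hm hlam ⟨F, F.2.1⟩ ⟨G, G.2.1⟩ n).symm

/-- Smooth approximations of the unit contraction do not increase the energy. -/
theorem diffusionEnergy_comp_le (hd : 0 < d) (F : cylinderSubmodule d) {η : ℝ → ℝ}
    (hη : η.HasTemperateGrowth) (hη' : ∀ t, ∃ c, |c| ≤ 1 ∧ HasDerivAt η c t) :
    diffusionEnergy lam m (η ∘ (F : PathSpace d → ℝ)) ≤ diffusionEnergy lam m F := by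
  refine ENNReal.tsum_le_tsum fun n => ?_
  refine mul_le_mul_right (lintegral_mono fun γ => ENNReal.ofReal_le_ofReal ?_) _
  obtain ⟨c, hc, h⟩ := hη' ((F : PathSpace d → ℝ) γ)
  have h1 : cmInner (schauder d n) (cylinderGradient (η ∘ (F : PathSpace d → ℝ)) γ) =
      c * cmInner (schauder d n) (cylinderGradient F γ) := schauderDeriv_comp hd n F hη γ h
  rw [h1, mul_pow, ← sq_abs c]
  exact mul_le_of_le_one_left (sq_nonneg _) (pow_le_one₀ (abs_nonneg _) hc)

theorem exists_mem_initialDomain_clamp (hd : 0 < d)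
    (hm : ∀ F ∈ cylinderFunctions d, MemLp F 2 m) (hlam : ∀ n, 0 < lam n)
    {F : PathSpace d → ℝ} (hF : F ∈ initialDomain lam m) {ε : ℝ} (hε : 0 < ε) :
    ∃ G ∈ initialDomain lam m, (∀ γ, |G γ - min (max (F γ) 0) 1| ≤ ε) ∧
      diffusionForm lam m G G ≤ diffusionForm lam m F F := by
  have hη := hasTemperateGrowth_softClamp hε
  have hG := comp_mem_cylinderFunctions hF.1 hη
  have hle : diffusionEnergy lam m (softClamp ε ∘ F) ≤ diffusionEnergy lam m F :=
    diffusionEnergy_comp_le hd ⟨F, hF.1⟩ hη (exists_hasDerivAt_softClamp hε)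
  refine ⟨softClamp ε ∘ F, ⟨hG, hle.trans_lt hF.2⟩, fun γ => abs_softClamp_sub_le hε (F γ), ?_⟩
  have h1 := diffusionForm_self hd hm hlam ⟨F, hF.1⟩
  have h2 := diffusionForm_self hd hm hlam ⟨softClamp ε ∘ F, hG⟩
  simp only at h1 h2
  rw [h1, h2]
  exact ENNReal.toReal_mono hF.2.ne hle

/-- The energy is a finite sum here, whatever the growth of `λ`. Density of the domain rests on
these functions. -/
theorem mem_initialDomain_of_dyadic (hd : 0 < d) {J : Finset dyadicTimes}
    {f : (J → EuclideanSpace ℝ (Fin d)) → ℝ} (hf : f.HasTemperateGrowth)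
    (hm : ∀ F ∈ cylinderFunctions d, MemLp F 2 m) (hlam : ∀ n, 0 < lam n) :
    (fun γ : PathSpace d => f (fun j => γ (j : dyadicTimes))) ∈ initialDomain lam m := by
  set F : cylinderSubmodule d := ⟨fun γ : PathSpace d => f (fun j => γ (j : dyadicTimes)),
    comp_eval_mem_cylinderFunctions (fun j : J => ((j : dyadicTimes) : I)) hf⟩ with hF
  refine ⟨F.2, ?_⟩
  obtain ⟨N, hN⟩ := eventually_schauderDeriv_eq_zero hd
    (fun j : J => ((j : dyadicTimes) : I)) (fun j => (j : dyadicTimes).2) (F := F) hf rfl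
  have h := diffusionEnergy_eq_tsum hd hm hlam F
  rw [tsum_eq_sum (s := Finset.range N)] at h
  · exact h.trans_lt (ENNReal.sum_lt_top.2 fun _ _ => ENNReal.ofReal_lt_top)
  · intro n hn
    rw [gradSeq_apply, hN n (by simpa using hn)]
    simp

theorem eq_zero_of_forall_dyadic [IsFiniteMeasure m] (u : Lp ℝ 2 m)
    (h : ∀ (J : Finset dyadicTimes) (f : (J → EuclideanSpace ℝ (Fin d)) → ℝ),
      f.HasTemperateGrowth →
        ∫ γ, u γ * f (fun j => γ (j : dyadicTimes)) ∂m = 0) : u = 0 := by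
  rw [Lp.eq_zero_iff_ae_eq_zero]
  exact ae_eq_zero_of_integral_cylinder_eq_zero dense_dyadicTimes
    ((Lp.memLp u).integrable (by norm_num)) fun J f hf _ => h J f hf

/-- The bound on the squared derivative factors into values of Schauder functions and an integrable
function of the path, so the energy is at most a product of `∫ B dm` and finitely many convergent
series, one per time. -/
theorem cylinderFunctions_subset_initialDomain (hd : 0 < d)
    (hm : ∀ F ∈ cylinderFunctions d, Integrable F m) (hlam : ∀ n, 0 < lam n)
    (hlam_mono : Monotone lam) (c : ℕ → Fin 2)
    (hsum : ∀ j : Fin d, Summable fun p : ℕ => lam (haarIndex d c (p + 1) j) / 2 ^ (p + 1)) :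
    cylinderFunctions d ⊆ initialDomain lam m := by
  intro F hF
  refine ⟨hF, ?_⟩
  obtain ⟨k, s, B, hB, hle⟩ := exists_sq_schauderDeriv_le hd ⟨F, hF⟩
  have hBfin : ∫⁻ γ, ENNReal.ofReal (B γ) ∂m < ∞ := (hm B hB).lintegral_lt_top
  set a : ℕ → Fin k → ℝ := fun n i => (∫ u in (0 : ℝ)..s i, haar (n / d) u) ^ 2 with ha
  calc diffusionEnergy lam m F
      ≤ ∑' n, ENNReal.ofReal (lam n) * ∫⁻ γ, ENNReal.ofReal (∑ i, a n i) *
          ENNReal.ofReal (B γ) ∂m := by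
        refine ENNReal.tsum_le_tsum fun n => ?_
        gcongr with γ
        rw [← ENNReal.ofReal_mul (Finset.sum_nonneg fun i _ => sq_nonneg _)]
        exact ENNReal.ofReal_le_ofReal (hle n γ)
    _ = (∑' n, ENNReal.ofReal (lam n) * ENNReal.ofReal (∑ i, a n i)) *
          ∫⁻ γ, ENNReal.ofReal (B γ) ∂m := by
        rw [← ENNReal.tsum_mul_right]
        refine tsum_congr fun n => ?_
        rw [lintegral_const_mul' _ _ ENNReal.ofReal_ne_top, mul_assoc]
    _ = (∑ i, ∑' n, ENNReal.ofReal (lam n) * ENNReal.ofReal (a n i)) *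
          ∫⁻ γ, ENNReal.ofReal (B γ) ∂m := by
        congr 1
        rw [← Summable.tsum_finsetSum fun _ _ => ENNReal.summable]
        refine tsum_congr fun n => ?_
        rw [ENNReal.ofReal_sum_of_nonneg fun i _ => sq_nonneg _, Finset.mul_sum]
    _ < ∞ := ENNReal.mul_lt_top (ENNReal.sum_lt_top.2 fun i _ =>
        tsum_mul_sq_integral_haar_lt_top hd hlam_mono c hsum hlam (s i).2.1) hBfin

end Gradient

/-! ### The main theorem -/

section Main

variable {d : ℕ} {ν : Measure (PathSpace d)} {φ : PathSpace d → ℝ} {c : ℝ} {lam : ℕ → ℝ}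

theorem eq_zero_of_forall_integral_mul_eq_zero [IsFiniteMeasure ν]
    (u : Lp ℝ 2 (weightedMeasure ν φ)) (hint : Integrable u ν)
    (h : ∀ G ∈ cylinderFunctions d, ∫ γ, G γ * u γ ∂ν = 0) : u = 0 := by
  rw [Lp.eq_zero_iff_ae_eq_zero]
  refine weightedMeasure_absolutelyContinuous.ae_eq ?_
  refine ae_eq_zero_of_integral_cylinder_eq_zero dense_dyadicTimes hint fun J f hf _ => ?_
  rw [← h _ (comp_eval_mem_cylinderFunctions (fun j : J => ((j : dyadicTimes) : I)) hf)]
  exact integral_congr_ae (ae_of_all _ fun γ => mul_comm _ _)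

/-- Each component of `y` is tested against cylindrical functions under `ν`. Both the test
functional and its image under the adjoint derivative are continuous on `L²(φν)`, so the two limits
can be compared. -/
theorem diffusionGrad_closable (hd : 0 < d) (hν : IsWienerMeasure ν)
    (hφm : AEMeasurable φ ν) (hc : ∀ᵐ γ ∂ν, 0 < φ γ ∧ φ γ ≤ c)
    (hφ : ∀ F ∈ cylinderFunctions d, Integrable (fun γ => F γ / φ γ) ν)
    (hm : ∀ F ∈ cylinderFunctions d, MemLp F 2 (weightedMeasure ν φ))
    (F : ℕ → finiteEnergySubmodule hd hm lam)
    (y : lp (fun _ : ℕ => Lp ℝ 2 (weightedMeasure ν φ)) 2)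
    (hF : Tendsto (fun k => eLpNorm (F k : PathSpace d → ℝ) 2 (weightedMeasure ν φ)) atTop (𝓝 0))
    (hy : Tendsto (fun k => diffusionGrad hd hm lam (F k)) atTop (𝓝 y)) : y = 0 := by
  have := hν.isProbabilityMeasure
  have hint : ∀ F ∈ cylinderFunctions d, Integrable F ν := fun F hF =>
    integrable_of_integrable_div hφm hc (hφ F hF)
  set Z : ℕ → cylinderSubmodule d := fun k => ⟨F k, (F k).2.1⟩ with hZ
  have hF0 : Tendsto (fun k => cylinderToLp hm (Z k)) atTop (𝓝 0) := by
    rw [tendsto_zero_iff_norm_tendsto_zero]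
    exact ((ENNReal.tendsto_toReal ENNReal.zero_ne_top).comp hF).congr fun k =>
      (Lp.norm_toLp _ (hm _ (Z k).2)).symm
  ext1
  funext n
  have hyn : Tendsto (fun k => gradSeq hd hm lam (Z k) n) atTop (𝓝 (y n)) :=
    ((lp.evalCLM ℝ (fun _ : ℕ => Lp ℝ 2 (weightedMeasure ν φ)) 2 n).continuous.tendsto y).comp hy
  obtain ⟨W, hW, hibp⟩ := hν.exists_integral_cmInner_eq hd hint n
  have hpair : ∀ (G : PathSpace d → ℝ) (hG : G ∈ cylinderFunctions d)
      (w : Lp ℝ 2 (weightedMeasure ν φ)),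
      (∀ u : Lp ℝ 2 (weightedMeasure ν φ),
        Integrable (fun γ => G γ * u γ) ν ∧ inner ℝ w u = ∫ γ, G γ * u γ ∂ν) →
      ∀ H : cylinderSubmodule d, inner ℝ w (cylinderToLp hm H) =
        ∫ γ, G γ * (H : PathSpace d → ℝ) γ ∂ν := by
    intro G hG w hw H
    rw [(hw _).2]
    refine integral_congr_ae ?_
    filter_upwards [(absolutelyContinuous_weightedMeasure hφm hc).ae_eq
      (coeFn_cylinderToLp hm H)] with γ hγ
    rw [hγ]
  refine eq_zero_of_forall_integral_mul_eq_zero (y n) ?_ fun G hG => ?_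
  · obtain ⟨w, hw⟩ := exists_inner_eq_integral hφm hc hφ (const_mem_cylinderFunctions 1)
    simpa using (hw (y n)).1
  · obtain ⟨w, hw⟩ := exists_inner_eq_integral hφm hc hφ hG
    -- `G'` is the adjoint derivative of `G` under `ν`.
    set G' : cylinderSubmodule d := ⟨G * W, mul_mem_cylinderFunctions hG hW⟩ -
      schauderDeriv hd n ⟨G, hG⟩ with hG'
    obtain ⟨w', hw'⟩ := exists_inner_eq_integral hφm hc hφ G'.2
    rw [← (hw (y n)).2]
    have hstep : ∀ H : cylinderSubmodule d, inner ℝ w (gradSeq hd hm lam H n) =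
        √(lam n) * inner ℝ w' (cylinderToLp hm H) := by
      intro H
      rw [gradSeq_apply, inner_smul_right, hpair G hG w hw, hpair G' G'.2 w' hw']
      congr 1
      -- Integration by parts for the product `H G`, combined with the Leibniz rule, moves the
      -- derivative from `H` to `G`.
      have h1 := hibp _ (mul_mem_cylinderFunctions H.2 hG)
      have h2 := schauderDeriv_mul hd n H ⟨G, hG⟩
      have h3 : ∫ γ, (schauderDeriv hd n H : PathSpace d → ℝ) γ * G γ +
          (H : PathSpace d → ℝ) γ * (schauderDeriv hd n ⟨G, hG⟩ : PathSpace d → ℝ) γ ∂ν =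
          ∫ γ, (H : PathSpace d → ℝ) γ * G γ * W γ ∂ν :=
        (integral_congr_ae (ae_of_all _ fun γ => (h2 γ).symm)).trans h1
      have i1 : Integrable (fun γ => (schauderDeriv hd n H : PathSpace d → ℝ) γ * G γ) ν :=
        hint _ (mul_mem_cylinderFunctions (schauderDeriv hd n H).2 hG)
      have i2 : Integrable (fun γ => (H : PathSpace d → ℝ) γ *
          (schauderDeriv hd n ⟨G, hG⟩ : PathSpace d → ℝ) γ) ν :=
        hint _ (mul_mem_cylinderFunctions H.2 (schauderDeriv hd n ⟨G, hG⟩).2)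
      have i3 : Integrable (fun γ => (H : PathSpace d → ℝ) γ * G γ * W γ) ν :=
        hint _ (mul_mem_cylinderFunctions (mul_mem_cylinderFunctions H.2 hG) hW)
      rw [integral_add i1 i2, ← eq_sub_iff_add_eq, ← integral_sub i3 i2] at h3
      calc _ = ∫ γ, (schauderDeriv hd n H : PathSpace d → ℝ) γ * G γ ∂ν :=
            integral_congr_ae (ae_of_all _ fun γ => mul_comm _ _)
        _ = _ := h3
        _ = _ := by
            refine integral_congr_ae (ae_of_all _ fun γ => ?_)
            simp only [hG', Submodule.coe_sub, Pi.sub_apply, Pi.mul_apply]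
            ring
    have hlim1 : Tendsto (fun k => inner ℝ w (gradSeq hd hm lam (Z k) n)) atTop
        (𝓝 (inner ℝ w (y n))) := tendsto_const_nhds.inner hyn
    have hlim2 : Tendsto (fun k => inner ℝ w (gradSeq hd hm lam (Z k) n)) atTop (𝓝 0) := by
      have : Tendsto (fun k => √(lam n) * inner ℝ w' (cylinderToLp hm (Z k))) atTop
          (𝓝 (√(lam n) * inner ℝ w' (0 : Lp ℝ 2 (weightedMeasure ν φ)))) :=
        (tendsto_const_nhds.inner hF0).const_mul _
      rw [inner_zero_right, mul_zero] at this
      exact this.congr fun k => (hstep (Z k)).symm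
    exact tendsto_nhds_unique hlim1 hlim2

/-- The diffusion form as a closable gradient form. -/
def diffusionClosableGradient (hd : 0 < d) (hν : IsWienerMeasure ν) (hlam : ∀ n, 0 < lam n)
    (hφm : AEMeasurable φ ν) (hc : ∀ᵐ γ ∂ν, 0 < φ γ ∧ φ γ ≤ c)
    (hφ : ∀ F ∈ cylinderFunctions d, Integrable (fun γ => F γ / φ γ) ν)
    (hm : ∀ F ∈ cylinderFunctions d, MemLp F 2 (weightedMeasure ν φ)) :
    ClosableGradient (weightedMeasure ν φ) (initialDomain lam (weightedMeasure ν φ))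
      (diffusionForm lam (weightedMeasure ν φ))
      (lp (fun _ : ℕ => Lp ℝ 2 (weightedMeasure ν φ)) 2) where
  space := finiteEnergySubmodule hd hm lam
  mem_space := mem_finiteEnergySubmodule hd hm hlam
  memLp F := hm F F.2.1
  grad := diffusionGrad hd hm lam
  form_eq := diffusionForm_eq_inner hd hm hlam
  closable := diffusionGrad_closable hd hν hφm hc hφ hm

/-- A vector orthogonal to the domain is orthogonal to all cylindrical functions with dyadic times,
and these determine it. -/
theorem dense_range_toLp (hd : 0 < d) (hν : IsWienerMeasure ν) (hlam : ∀ n, 0 < lam n)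
    (hφm : AEMeasurable φ ν) (hc : ∀ᵐ γ ∂ν, 0 < φ γ ∧ φ γ ≤ c)
    (hφ : ∀ F ∈ cylinderFunctions d, Integrable (fun γ => F γ / φ γ) ν)
    (hm : ∀ F ∈ cylinderFunctions d, MemLp F 2 (weightedMeasure ν φ)) :
    Dense (range (diffusionClosableGradient hd hν hlam hφm hc hφ hm).toLp) := by
  have := hν.isProbabilityMeasure
  have := isFiniteMeasure_weightedMeasure hc
  set S := diffusionClosableGradient hd hν hlam hφm hc hφ hm with hS
  have h : Dense (LinearMap.range S.toLp : Set (Lp ℝ 2 (weightedMeasure ν φ))) := by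
    rw [Submodule.dense_iff_topologicalClosure_eq_top, Submodule.topologicalClosure_eq_top_iff,
      Submodule.eq_bot_iff]
    intro u hu
    refine eq_zero_of_forall_dyadic u fun J f hf => ?_
    have hF := mem_initialDomain_of_dyadic hd hf hm hlam
    have h1 := hu _ ⟨⟨_, (S.mem_space _).2 hF⟩, rfl⟩
    rw [L2.inner_def] at h1
    rw [← h1]
    refine integral_congr_ae ?_
    filter_upwards [(hm _ hF.1).coeFn_toLp] with γ hγ
    have h2 : (S.toLp ⟨_, (S.mem_space _).2 hF⟩ : PathSpace d → ℝ) γ =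
      f (fun j => γ (j : dyadicTimes)) := hγ
    rw [h2]
    rfl
  rwa [LinearMap.coe_range] at h

end Main

end

theorem mainTheorem6 {d : ℕ} (hd : 0 < d)
    (ν : Measure (PathSpace d)) (hν : IsWienerMeasure ν)
    (lam : ℕ → ℝ) (hlam_pos : ∀ n, 0 < lam n) (hlam_mono : Monotone lam)
    (φ : PathSpace d → ℝ) (hφ_meas : AEMeasurable φ ν)
    (hφ_bdd : ∃ c : ℝ, ∀ᵐ γ ∂ν, 0 < φ γ ∧ φ γ ≤ c)
    (hφ : ∀ F ∈ cylinderFunctions d, Integrable (fun γ => F γ / φ γ) ν) :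
    (∀ c : ℕ → Fin 2,
      (∀ j : Fin d, Summable (fun p : ℕ => lam (haarIndex d c (p + 1) j) / 2 ^ (p + 1))) →
        initialDomain lam (weightedMeasure ν φ) = cylinderFunctions d) ∧
    IsClosableForm (weightedMeasure ν φ) (initialDomain lam (weightedMeasure ν φ))
      (diffusionForm lam (weightedMeasure ν φ)) ∧
    ∃ Q : L2Form (weightedMeasure ν φ),
      Q.IsClosureOf (initialDomain lam (weightedMeasure ν φ))
        (diffusionForm lam (weightedMeasure ν φ)) ∧
      Q.IsDirichletForm := by
  obtain ⟨c, hc⟩ := hφ_bdd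
  have := hν.isProbabilityMeasure
  have := isFiniteMeasure_weightedMeasure hc
  have hm : ∀ F ∈ cylinderFunctions d, MemLp F 2 (weightedMeasure ν φ) := fun F hF =>
    memLp_two_weightedMeasure hφ_meas hc hφ hF
  let S := diffusionClosableGradient hd hν hlam_pos hφ_meas hc hφ hm
  refine ⟨fun b hb => Subset.antisymm (fun F hF => hF.1) ?_, S.isClosableForm, S.closedForm,
    S.isClosureOf, S.closedForm_isDirichletForm
      (dense_range_toLp hd hν hlam_pos hφ_meas hc hφ hm) fun F hF ε hε =>
        exists_mem_initialDomain_clamp hd hm hlam_pos hF hε⟩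
  exact cylinderFunctions_subset_initialDomain hd
    (fun F hF => (hm F hF).integrable (by norm_num)) hlam_pos hlam_mono b hb
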